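/- Let $0<r<n\le 2r$, $\alpha,\beta\in\mathbb C$, $C\in M_{r,n-r}(\mathbb C)$, $D\in M_{n-r,r}(\mathbb C)$ and $$A=\begin{bmatrix}\alpha I_r & C\\ D&\beta I_{n-r}\end{bmatrix}\in M_n(\mathbb C).$$ Suppose that $Z=DC$ is normal and commutes with $H=C^*C+DD^*$. Then $Z$ and $H$ are diagonalized by one and the same unitary matrix. Take any such simultaneous diagonalization, with diagonal entries $z_j$ of $Z$ and $h_j$ of $H$ (in the same order, $j=1,\dots,n-r$), and put $\Delta_j=(\alpha-\beta)^2+4z_j$. Then $$a_j=\sqrt{\tfrac12|\alpha-\beta|^2+h_j+\tfrac12|\Delta_j|},\qquad b_j=\sqrt{\tfrac12|\alpha-\beta|^2+h_j-\tfrac12|\Delta_j|}$$ have non-negative radicands, and there is an ellipse $\hat{\mathcal E}_j$ with foci $\tfrac12(\alpha+\beta)\pm\tfrac12\sqrt{\Delta_j}$, major axis of length $a_j$ and minor axis of length $b_j$. (If $b_j=0$ the ellipse is degenerate, and $\hat{\mathcal E}_j$ means the pair of its foci, which is a single point if $a_j=0$.) For a matrix $A\in M_n(\mathbb C)$ write $\operatorname{Re}A=\frac12(A+A^*)$,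 $\operatorname{Im}A=\frac1{2i}(A-A^*)$. The Kippenhahn curve $C(A)$ is the set of $x+iy$ ($x,y\in\mathbb R$) such that $(x:y:1)$ lies on the dual of some irreducible component of the projective curve $\det(u\operatorname{Re}A+v\operatorname{Im}A+tI_n)=0$, where the dual of a component is the Zariski closure of the set of its tangent lines at nonsingular points (so the dual of a line is a point). Further, $W(A)=\{x^*Ax: x^*x=1\}$ is the numerical range, and $\Lambda_k(A)$ is the set of $\lambda\in\mathbb C$ with $PAP=\lambda P$ for some orthogonal projection $P$ of rank $k$. The following hold. (a) If $n<2r$, then $C(A)=\hat{\mathcal E}_1\cup\dots\cup\hat{\mathcal E}_{n-r}\cup\{\alpha\}$; if $n=2r$, then $C(A)=\hat{\mathcal E}_1\cup\dots\cup\hat{\mathcal E}_{n/2}$. In both cases $W(A)$ is the convex hull of $\hat{\mathcal E}_1\cup\dots\cup\hat{\mathcal E}_{n-r}$. (b) For $1\le k\le n-r$, $$\Lambda_k(A)=\bigcap_{1\le j_1<\dots<j_{n-r-k+1}\le n-r}\operatorname{conv}\big(\hat{\mathcal E}_{j_1}\cup\dots\cup\hat{\mathcal E}_{j_{n-r-k+1}}\big).$$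 Let $m$ be the number of indices $j$ with $a_j=0$, that is, for which $\hat{\mathcal E}_j$ is a single point ($m=0$ unless $\alpha=\beta$). Then $\Lambda_k(A)=\{\alpha\}$ for $n-r<k\le r+m$, and $\Lambda_k(A)=\emptyset$ for $r+m<k\le n$. In particular, if no $\hat{\mathcal E}_j$ is a single point, then $\Lambda_k(A)=\{\alpha\}$ for $n-r<k\le r$ and $\Lambda_k(A)=\emptyset$ for $r<k\le n$ (for $n=2r$ the first range is empty). -/

import Mathlib

open scoped Matrix

noncomputable section

namespace HigherRank

variable {ι : Type*} [Fintype ι] [DecidableEq ι]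

/-- The numerical range `W(A) = {⟨A x, x⟩ : ⟨x, x⟩ = 1}`. -/
def numericalRange (A : Matrix ι ι ℂ) : Set ℂ :=
  {w | ∃ x : ι → ℂ, star x ⬝ᵥ x = 1 ∧ star x ⬝ᵥ (A *ᵥ x) = w}

/-- The rank-`k` numerical range `Λ_k(A)`: all `w` with `P A P = w P` for some orthogonal
projection `P` of rank `k`. -/
def higherRankNumericalRange (k : ℕ) (A : Matrix ι ι ℂ) : Set ℂ :=
  {w | ∃ P : Matrix ι ι ℂ, P.IsHermitian ∧ P * P = P ∧ P.rank = k ∧ P * A * P = w • P}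

/-- `Re A = (A + A^*) / 2`. -/
def hermitianRe (A : Matrix ι ι ℂ) : Matrix ι ι ℂ :=
  (1 / 2 : ℂ) • (A + Aᴴ)

/-- `Im A = (A - A^*) / (2 i)`. -/
def hermitianIm (A : Matrix ι ι ℂ) : Matrix ι ι ℂ :=
  (1 / (2 * Complex.I)) • (A - Aᴴ)

/-- The ternary form `det (u Re A + v Im A + t I)` in the variables `u = X 0`, `v = X 1`,
`t = X 2`. A real triple `(u, v, t)` with `u = cos θ`, `v = sin θ` is a zero exactly if
`-t` is an eigenvalue of `Re (e^{-iθ} A)`; it stands for the line `u x + v y + t = 0`. -/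
def kippenhahnPolynomial (A : Matrix ι ι ℂ) : MvPolynomial (Fin 3) ℂ :=
  Matrix.det
    ((MvPolynomial.X 0 : MvPolynomial (Fin 3) ℂ) • (hermitianRe A).map MvPolynomial.C
      + (MvPolynomial.X 1 : MvPolynomial (Fin 3) ℂ) • (hermitianIm A).map MvPolynomial.C
      + (MvPolynomial.X 2 : MvPolynomial (Fin 3) ℂ) • 1)

/-- The gradient of `f` at the point `p`. -/
def formGradient (f : MvPolynomial (Fin 3) ℂ) (p : Fin 3 → ℂ) : Fin 3 → ℂ :=
  fun i => MvPolynomial.eval p (MvPolynomial.pderiv i f)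

/-- The dual of the projective plane curve `f = 0` (for an irreducible form `f`), in
homogeneous coordinates: the Zariski closure of the set of tangent lines of the curve at its
nonsingular points. The dual of a line is a point. -/
def dualCurve (f : MvPolynomial (Fin 3) ℂ) : Set (Fin 3 → ℂ) :=
  {q | ∀ (d : ℕ) (g : MvPolynomial (Fin 3) ℂ), g.IsHomogeneous d →
      (∀ p : Fin 3 → ℂ, MvPolynomial.eval p f = 0 → formGradient f p ≠ 0 →
        MvPolynomial.eval (formGradient f p) g = 0) →
      MvPolynomial.eval q g = 0}

/-- The Kippenhahn curve (boundary generating curve) `C(A)`: the real affine part of the dual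
of the curve `det (u Re A + v Im A + t I) = 0`, the dual being taken of each irreducible
component; the point `x + i y` has homogeneous coordinates `(x, y, 1)`. -/
def kippenhahnCurve (A : Matrix ι ι ℂ) : Set ℂ :=
  {z | ∃ f : MvPolynomial (Fin 3) ℂ, Irreducible f ∧ f ∣ kippenhahnPolynomial A ∧
      ![(z.re : ℂ), (z.im : ℂ), 1] ∈ dualCurve f}

/-- `E` is the ellipse with foci `f₁`, `f₂`, major axis of length `a` and minor axis of
length `b`. If `b = 0`, the ellipse is degenerate, and it is read, as a curve that is
enveloped by its tangent lines, as the pair of its foci (a single point if also `a = 0`). -/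
def IsEllipse (E : Set ℂ) (f₁ f₂ : ℂ) (a b : ℝ) : Prop :=
  0 ≤ a ∧ 0 ≤ b ∧ a ^ 2 = b ^ 2 + dist f₁ f₂ ^ 2 ∧
    (0 < b → E = {z | dist z f₁ + dist z f₂ = a}) ∧ (b = 0 → E = {f₁, f₂})

/-- `z j`, `h j` are the joint eigenvalues of `Z` and of the Hermitian matrix `H`: the diagonal
entries, in the same order, of a simultaneous diagonalization by one unitary matrix. -/
def IsJointEigenvalues (Z H : Matrix ι ι ℂ) (z : ι → ℂ) (h : ι → ℝ) : Prop :=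
  ∃ U ∈ Matrix.unitaryGroup ι ℂ,
    Uᴴ * Z * U = Matrix.diagonal z ∧ Uᴴ * H * U = Matrix.diagonal (fun j => (h j : ℂ))

/-- `Δ = (α - β)^2 + 4 z`. -/
def discr (α β z : ℂ) : ℂ := (α - β) ^ 2 + 4 * z

/-- The focus `(α + β) / 2 + √Δ / 2`. -/
def focusPlus (α β z : ℂ) : ℂ := (α + β) / 2 + discr α β z ^ (1 / 2 : ℂ) / 2

/-- The focus `(α + β) / 2 - √Δ / 2`. -/
def focusMinus (α β z : ℂ) : ℂ := (α + β) / 2 - discr α β z ^ (1 / 2 : ℂ) / 2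

/-- The square of the length of the major axis. -/
def majorSq (α β z : ℂ) (h : ℝ) : ℝ := ‖α - β‖ ^ 2 / 2 + h + ‖discr α β z‖ / 2

/-- The square of the length of the minor axis. -/
def minorSq (α β z : ℂ) (h : ℝ) : ℝ := ‖α - β‖ ^ 2 / 2 + h - ‖discr α β z‖ / 2

end HigherRank

end

/-!
# Kippenhahn curve and higher rank numerical ranges of a block matrix with scalar diagonal blocks

After a unitary change of basis of `ℂ^(n - r)` one may assume `D C = diag z` and
`C^* C + D D^* = diag h`. Then `ω C + \bar ω D^*` has orthogonal columns for every `ω`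
(`conjTranspose_mul_self_eq_diagonal`), although `C` and `D^*` need not have a common singular
value decomposition, so that `A` itself is in general no direct sum of `2 × 2` matrices.

*The Kippenhahn curve.* By the Schur complement the form `det (u Re A + v Im A + t)` is
a power of a linear form with zero `α` times the product of one quadratic form for each `j`
(`kippenhahnPolynomial_fromBlocks`). The dual of the `j`-th conic is the `j`-th ellipse
(`componentDuals_dualConic`); if the ellipse degenerates, the quadratic form is the product of the
linear forms of the two foci.

*The higher rank numerical ranges.* A number `μ` is in `Λ_k(A)` if and only if the form
`x ↦ x^* (A - μ) x` vanishes on a subspace of dimension `k` (`mem_higherRankNumericalRange_iff`).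
By separation, `μ` is in the convex hull of the ellipses with index in `J` if and only if for no `ω`
the support functions of all of them are negative with respect to `μ`
(`mem_convexHull_biUnion_ellipseOf_iff`); negativity of the `j`-th support function is the negative
definiteness of a `2 × 2` matrix, `IsNegDirection`. So the claim is that an isotropic subspace of
dimension `k` exists if and only if no `ω` is a negative direction for more than `n - r - k`
indices `j`.

Necessity holds because `Re (ω (A - μ))` is negative definite on a subspace whose dimension is `r`
plus the number of those indices (`add_card_le_of_isNegDirection`). For sufficiency one normalizes
`α - μ = 1` and restricts the form to the vectors `(W x - L y / 2, y)`, where `L = C + D^*` and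
`W` is an isometry with `C - D^* = W κ`; the restriction is a direct sum of forms in two variables
(`exists_injective_restrict_eq_pencilMatrix`). The `σ` for which `-(1 + i σ)` is a
negative direction for the `j`-th summand form an interval between the roots of a quadratic
polynomial, and at most `g = n - r - k` of these intervals have a common point. So they can be
coloured with `g` colours such that intervals of the same colour are disjoint
(`exists_coloring_of_intervals`). The summands of one colour, `m` of them, have an isotropic
subspace of dimension `m - 1`, which Lagrange interpolation at the endpoints of the intervals
provides (`hasIsotropicSubspaceOn_of_disjoint_intervals`). Summands without an interval have an
isotropic vector, and the limit cases follow from the compactness of the set of isometries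
(`isClosed_setOf_hasIsotropicSubspace`).

For `k > n - r` the argument for necessity leaves only `μ = α`, and the largest isotropic subspace
of `A - α` is found directly (`alpha_mem_higherRankNumericalRange_fromBlocks_iff`).
-/

namespace HigherRank

/-! ### Isotropic subspaces and higher rank numerical ranges -/

section Isotropic

variable {ι κ : Type*} [Fintype ι] [Fintype κ]

/-- The form `x ↦ x^* A x` vanishes identically on some subspace of dimension at least `k`. -/
def HasIsotropicSubspace (A : Matrix ι ι ℂ) (k : ℕ) : Prop :=
  ∃ W : Submodule ℂ (ι → ℂ), k ≤ Module.finrank ℂ W ∧ ∀ x ∈ W, star x ⬝ᵥ (A *ᵥ x) = 0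

lemma HasIsotropicSubspace.mono {A : Matrix ι ι ℂ} {k l : ℕ} (h : HasIsotropicSubspace A k)
    (hl : l ≤ k) : HasIsotropicSubspace A l := by
  obtain ⟨W, hW, h⟩ := h
  exact ⟨W, hl.trans hW, h⟩

lemma HasIsotropicSubspace.smul {A : Matrix ι ι ℂ} {k : ℕ} (h : HasIsotropicSubspace A k)
    (c : ℂ) : HasIsotropicSubspace (c • A) k := by
  obtain ⟨W, hW, h⟩ := h
  refine ⟨W, hW, fun x hx => ?_⟩
  rw [Matrix.smul_mulVec, dotProduct_smul, h x hx, smul_zero]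

/-- A complex matrix is determined by its quadratic form. -/
lemma eq_zero_of_forall_dotProduct_mulVec_eq_zero [DecidableEq ι] {B : Matrix ι ι ℂ}
    (h : ∀ x : ι → ℂ, star x ⬝ᵥ (B *ᵥ x) = 0) : B = 0 := by
  have : Matrix.toEuclideanLin B = 0 := by
    rw [← inner_map_self_eq_zero]
    intro x
    have := congrArg star (h x.ofLp)
    rw [star_zero, Matrix.star_dotProduct, star_star] at this
    rw [EuclideanSpace.inner_eq_star_dotProduct]
    simpa [dotProduct_comm] using this
  simpa using this

lemma star_mulVec_dotProduct_mulVec (X : Matrix ι κ ℂ) (A : Matrix ι ι ℂ) (x : κ → ℂ) :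
    star (X *ᵥ x) ⬝ᵥ (A *ᵥ (X *ᵥ x)) = star x ⬝ᵥ ((Xᴴ * A * X) *ᵥ x) := by
  rw [Matrix.star_mulVec, ← Matrix.dotProduct_mulVec, Matrix.mulVec_mulVec, Matrix.mulVec_mulVec,
    Matrix.mul_assoc]

/-- An isotropic subspace of a restriction of the form is one of the form. -/
lemma HasIsotropicSubspace.of_restrict {A : Matrix ι ι ℂ} {X : Matrix ι κ ℂ} {k : ℕ}
    (hX : Function.Injective X.mulVec) (h : HasIsotropicSubspace (Xᴴ * A * X) k) :
    HasIsotropicSubspace A k := by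
  obtain ⟨W, hW, h⟩ := h
  refine ⟨W.map X.mulVecLin, ?_, ?_⟩
  · rwa [(Submodule.equivMapOfInjective X.mulVecLin hX W).finrank_eq.symm]
  · rintro _ ⟨x, hx, rfl⟩
    rw [Matrix.mulVecLin_apply, star_mulVec_dotProduct_mulVec, h x hx]

lemma mulVec_injective_of_conjTranspose_mul_self [DecidableEq κ] {X : Matrix ι κ ℂ}
    (hX : Xᴴ * X = 1) : Function.Injective X.mulVec := by
  intro x y hxy
  have := congrArg (Xᴴ *ᵥ ·) hxy
  simpa [Matrix.mulVec_mulVec, hX] using this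

/-- An isotropic subspace can be given by an isometry `V` with `V^* A V = 0`. -/
lemma hasIsotropicSubspace_iff {A : Matrix ι ι ℂ} {k : ℕ} :
    HasIsotropicSubspace A k ↔ ∃ V : Matrix ι (Fin k) ℂ, Vᴴ * V = 1 ∧ Vᴴ * A * V = 0 := by
  constructor
  · rintro ⟨W, hW, h⟩
    let e := (WithLp.linearEquiv 2 ℂ (ι → ℂ)).symm
    let W' : Submodule ℂ (EuclideanSpace ℂ ι) := W.map e.toLinearMap
    have hW' : k ≤ Module.finrank ℂ W' := by
      rwa [LinearEquiv.finrank_map_eq e W]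
    let b := stdOrthonormalBasis ℂ W'
    let V : Matrix ι (Fin k) ℂ := Matrix.of fun i j => (b (Fin.castLE hW' j) : EuclideanSpace ℂ ι) i
    have hcol (x : Fin k → ℂ) : V *ᵥ x ∈ W := by
      have h1 : V *ᵥ x = ∑ j, x j • (b (Fin.castLE hW' j) : EuclideanSpace ℂ ι).ofLp := by
        ext i
        simp [V, Matrix.mulVec, dotProduct, mul_comm]
      rw [h1]
      refine W.sum_mem fun j _ => W.smul_mem _ ?_
      obtain ⟨w, hw, hw'⟩ := (b (Fin.castLE hW' j)).2
      rw [← hw']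
      exact hw
    refine ⟨V, ?_, ?_⟩
    · ext i j
      have := orthonormal_iff_ite.mp b.orthonormal (Fin.castLE hW' i) (Fin.castLE hW' j)
      rw [Submodule.coe_inner, EuclideanSpace.inner_eq_star_dotProduct] at this
      rw [Matrix.mul_apply, Matrix.one_apply]
      simp only [Fin.castLE_inj] at this
      rw [← this]
      simp [V, dotProduct, mul_comm]
    · apply eq_zero_of_forall_dotProduct_mulVec_eq_zero
      intro x
      rw [← star_mulVec_dotProduct_mulVec]
      exact h _ (hcol x)
  · rintro ⟨V, hV, h⟩
    apply HasIsotropicSubspace.of_restrict (mulVec_injective_of_conjTranspose_mul_self hV)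
    rw [h]
    exact ⟨⊤, by simp, by simp⟩

lemma mem_higherRankNumericalRange_iff [DecidableEq ι] {A : Matrix ι ι ℂ} {k : ℕ} {w : ℂ} :
    w ∈ higherRankNumericalRange k A ↔ HasIsotropicSubspace (A - w • 1) k := by
  constructor
  · rintro ⟨P, hP, hPP, hrank, h⟩
    refine ⟨LinearMap.range P.mulVecLin, hrank.ge, ?_⟩
    rintro _ ⟨x, rfl⟩
    rw [Matrix.mulVecLin_apply, star_mulVec_dotProduct_mulVec, hP.eq, Matrix.mul_sub,
      Matrix.sub_mul, h]
    simp [hPP]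
  · rw [hasIsotropicSubspace_iff]
    rintro ⟨V, hV, h⟩
    have hV' : Vᴴ * A * V = w • 1 := by
      rw [Matrix.mul_sub, Matrix.sub_mul, sub_eq_zero] at h
      simpa [hV] using h
    refine ⟨V * Vᴴ, Matrix.isHermitian_mul_conjTranspose_self V, ?_, ?_, ?_⟩
    · rw [Matrix.mul_assoc, ← Matrix.mul_assoc Vᴴ, hV, Matrix.one_mul]
    · open scoped ComplexOrder in
      rw [Matrix.rank_self_mul_conjTranspose, ← Matrix.rank_conjTranspose_mul_self, hV]
      simp
    · calc V * Vᴴ * A * (V * Vᴴ) = V * (Vᴴ * A * V) * Vᴴ := by simp only [Matrix.mul_assoc]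
        _ = _ := by rw [hV']; simp

/-- A subspace without isotropic vectors bounds the dimension of an isotropic subspace. -/
lemma HasIsotropicSubspace.add_finrank_le {A : Matrix ι ι ℂ} {k : ℕ}
    (h : HasIsotropicSubspace A k) {N : Submodule ℂ (ι → ℂ)}
    (hN : ∀ x ∈ N, star x ⬝ᵥ (A *ᵥ x) = 0 → x = 0) :
    k + Module.finrank ℂ N ≤ Fintype.card ι := by
  obtain ⟨W, hW, h⟩ := h
  have hd : Disjoint W N := by
    rw [Submodule.disjoint_def]
    exact fun x hx hx' => hN x hx' (h x hx)
  have := Submodule.finrank_add_finrank_le_of_disjoint hd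
  rw [Module.finrank_pi] at this
  omega

/-- The isotropy index can only jump up in a limit: the set of isometries is compact. -/
lemma isClosed_setOf_hasIsotropicSubspace (k : ℕ) :
    IsClosed {A : Matrix ι ι ℂ | HasIsotropicSubspace A k} := by
  let K : Set (Matrix ι (Fin k) ℂ) := {V | Vᴴ * V = 1}
  have hK : IsCompact K := by
    have hbox : IsCompact {V : Matrix ι (Fin k) ℂ | ∀ i, V i ∈
        {v : Fin k → ℂ | ∀ j, v j ∈ Metric.closedBall (0 : ℂ) 1}} :=
      isCompact_pi_infinite fun _ => isCompact_pi_infinite fun _ => isCompact_closedBall _ _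
    refine hbox.of_isClosed_subset ?_ ?_
    · exact isClosed_eq (by fun_prop) continuous_const
    · intro V hV i j
      have h1 : ∑ l, ‖V l j‖ ^ 2 = 1 := by
        have := congrFun (congrFun (show Vᴴ * V = 1 from hV) j) j
        rw [Matrix.mul_apply, Matrix.one_apply_eq] at this
        have h2 : ∀ l, Vᴴ j l * V l j = ((‖V l j‖ ^ 2 : ℝ) : ℂ) := fun l => by
          rw [Matrix.conjTranspose_apply, ← starRingEnd_apply, Complex.conj_mul']
          norm_cast
        simp only [h2] at this
        exact_mod_cast this
      have h3 : ‖V i j‖ ^ 2 ≤ 1 :=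
        h1 ▸ Finset.single_le_sum (f := fun l => ‖V l j‖ ^ 2) (fun _ _ => by positivity)
          (Finset.mem_univ i)
      simpa using (sq_le_one_iff₀ (norm_nonneg _)).mp h3
  have h : {A : Matrix ι ι ℂ | HasIsotropicSubspace A k} =
      Prod.fst '' ({p : Matrix ι ι ℂ × Matrix ι (Fin k) ℂ | p.2ᴴ * p.1 * p.2 = 0} ∩
        (Set.univ ×ˢ K)) := by
    ext A
    simp only [Set.mem_ofPred_eq, hasIsotropicSubspace_iff, Set.mem_image, Set.mem_inter_iff,
      Set.mem_prod, Set.mem_univ, true_and, Prod.exists, exists_and_right, exists_eq_right, K]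
    exact exists_congr fun V => and_comm
  rw [h]
  have : CompactSpace K := isCompact_iff_compactSpace.mp hK
  have hcl : IsClosed {p : Matrix ι ι ℂ × K |
      (p.2.1 : Matrix ι (Fin k) ℂ)ᴴ * p.1 * (p.2.1 : Matrix ι (Fin k) ℂ) = 0} :=
    isClosed_eq (by fun_prop) continuous_const
  convert isClosedMap_fst_of_compactSpace _ hcl using 1
  ext A
  simp [K, and_comm]

lemma higherRankNumericalRange_conj [DecidableEq ι] {U : Matrix ι ι ℂ}
    (hU : U ∈ Matrix.unitaryGroup ι ℂ) (A : Matrix ι ι ℂ) (k : ℕ) :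
    higherRankNumericalRange k (Uᴴ * A * U) = higherRankNumericalRange k A := by
  have h1 : Uᴴ * U = 1 := Matrix.mem_unitaryGroup_iff'.mp hU
  have h2 : U * Uᴴ = 1 := Matrix.mem_unitaryGroup_iff.mp hU
  ext w
  rw [mem_higherRankNumericalRange_iff, mem_higherRankNumericalRange_iff]
  have h3 : Uᴴ * A * U - w • 1 = Uᴴ * (A - w • 1) * U := by
    simp [Matrix.mul_sub, Matrix.sub_mul, h1]
  rw [h3]
  refine ⟨HasIsotropicSubspace.of_restrict (mulVec_injective_of_conjTranspose_mul_self h1),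
    fun h => HasIsotropicSubspace.of_restrict (X := Uᴴ)
      (mulVec_injective_of_conjTranspose_mul_self (by simpa using h2)) ?_⟩
  have h4 : Uᴴᴴ * (Uᴴ * (A - w • 1) * U) * Uᴴ = A - w • 1 := by
    rw [Matrix.conjTranspose_conjTranspose]
    calc U * (Uᴴ * (A - w • 1) * U) * Uᴴ = (U * Uᴴ) * (A - w • 1) * (U * Uᴴ) := by
          simp only [Matrix.mul_assoc]
      _ = _ := by rw [h2, Matrix.one_mul, Matrix.mul_one]
  rwa [h4]

lemma numericalRange_eq_higherRankNumericalRange_one [DecidableEq ι] (A : Matrix ι ι ℂ) :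
    numericalRange A = higherRankNumericalRange 1 A := by
  ext w
  rw [mem_higherRankNumericalRange_iff]
  constructor
  · rintro ⟨x, hx, hw⟩
    refine ⟨ℂ ∙ x, ?_, ?_⟩
    · rw [finrank_span_singleton]
      rintro rfl
      simp at hx
    · intro y hy
      obtain ⟨c, rfl⟩ := Submodule.mem_span_singleton.mp hy
      simp [Matrix.sub_mulVec, Matrix.mulVec_smul, hw, Matrix.smul_mulVec, hx]
      right
      ring
  · rw [hasIsotropicSubspace_iff]
    rintro ⟨V, hV, h⟩
    have hV' : Vᴴ * A * V = w • 1 := by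
      rw [Matrix.mul_sub, Matrix.sub_mul, sub_eq_zero] at h
      simpa [hV] using h
    refine ⟨fun i => V i 0, ?_, ?_⟩
    · have := congrFun (congrFun hV 0) 0
      simpa [Matrix.mul_apply, dotProduct] using this
    · have := congrFun (congrFun hV' 0) 0
      rw [Matrix.mul_assoc] at this
      simpa [Matrix.mul_apply, dotProduct, Matrix.mulVec] using this

end Isotropic

/-! ### Colouring intervals -/

/-- Interval graphs are perfect: if no point lies in more than `g` of the intervals `[l i, r i]`,
then the intervals can be coloured with `g` colours so that intervals of the same colour are
disjoint. -/
lemma exists_coloring_of_intervals {S : Type*} [DecidableEq S] (l r : S → ℝ) (hlr : ∀ i, l i ≤ r i)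
    (g : ℕ) (G : Finset S)
    (hG : ∀ σ : ℝ, (G.filter fun i => l i ≤ σ ∧ σ ≤ r i).card ≤ g) :
    ∃ c : S → ℕ, (∀ i ∈ G, c i < g) ∧
      ∀ i ∈ G, ∀ j ∈ G, i ≠ j → c i = c j → r i < l j ∨ r j < l i := by
  induction G using Finset.induction_on_max_value l with
  | empty => exact ⟨fun _ => 0, by simp, by simp⟩
  | insert a G ha hmax ih =>
    obtain ⟨c, hc, hd⟩ := ih fun σ =>
      (Finset.card_le_card (Finset.filter_subset_filter _ (Finset.subset_insert a G))).trans (hG σ)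
    -- the intervals of `G` that meet `[l a, r a]` all contain `l a`
    let B := G.filter fun i => l i ≤ l a ∧ l a ≤ r i
    have hB : B.card < g := by
      have h1 := hG (l a)
      rw [Finset.filter_insert, if_pos ⟨le_rfl, hlr a⟩, Finset.card_insert_of_notMem
        (fun h => ha (Finset.mem_of_mem_filter a h))] at h1
      exact h1
    obtain ⟨m, hm, hmB⟩ : ∃ m ∈ Finset.range g, m ∉ B.image c :=
      Finset.exists_mem_notMem_of_card_lt_card
        (by simpa using Finset.card_image_le.trans_lt hB)
    have hnew : ∀ i ∈ G, c i = m → r i < l a := by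
      intro i hi him
      by_contra! hcon
      exact hmB (Finset.mem_image.mpr ⟨i, Finset.mem_filter.mpr ⟨hi, hmax i hi, hcon⟩, him⟩)
    have hne : ∀ i ∈ G, i ≠ a := fun i hi h => ha (h ▸ hi)
    refine ⟨Function.update c a m, ?_, ?_⟩
    · intro i hi
      rcases Finset.mem_insert.mp hi with rfl | hi
      · simpa using hm
      · rw [Function.update_of_ne (hne i hi)]
        exact hc i hi
    · intro i hi j hj hij hcij
      rcases Finset.mem_insert.mp hi with hia | hiG <;>
        rcases Finset.mem_insert.mp hj with hja | hjG
      · exact absurd (hia.trans hja.symm) hij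
      · rw [hia, Function.update_self, Function.update_of_ne (hne j hjG)] at hcij
        exact Or.inr (hia ▸ hnew j hjG hcij.symm)
      · rw [hja, Function.update_self, Function.update_of_ne (hne i hiG)] at hcij
        exact Or.inl (hja ▸ hnew i hiG hcij)
      · rw [Function.update_of_ne (hne i hiG), Function.update_of_ne (hne j hjG)] at hcij
        exact hd i hiG j hjG hij hcij

/-! ### Isotropic subspaces of a direct sum of forms in two variables -/

section Pencil

/-- The form of the matrix `[[1, κ / 2], [-κ / 2, -p + i q]]`. -/
noncomputable def blockForm (p q κ : ℝ) (a b : ℂ) : ℂ :=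
  star a * a + κ / 2 * (star a * b - star b * a) + (-p + Complex.I * q) * (star b * b)

variable {S : Type*} [Fintype S]

/-- The direct sum of the matrices `[[1, κ j / 2], [-κ j / 2, -p j + i q j]]`. -/
noncomputable def pencilMatrix [DecidableEq S] (p q κ : S → ℝ) : Matrix (S ⊕ S) (S ⊕ S) ℂ :=
  Matrix.fromBlocks 1 (Matrix.diagonal fun j => (κ j : ℂ) / 2)
    (-Matrix.diagonal fun j => (κ j : ℂ) / 2)
    (Matrix.diagonal fun j => -(p j : ℂ) + Complex.I * q j)

lemma star_dotProduct_pencilMatrix_mulVec [DecidableEq S] (p q κ : S → ℝ) (x : S ⊕ S → ℂ) :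
    star x ⬝ᵥ (pencilMatrix p q κ *ᵥ x) =
      ∑ j, blockForm (p j) (q j) (κ j) (x (Sum.inl j)) (x (Sum.inr j)) := by
  rw [pencilMatrix, Matrix.fromBlocks_mulVec, dotProduct, Fintype.sum_sum_type,
    ← Finset.sum_add_distrib]
  refine Finset.sum_congr rfl fun j _ => ?_
  simp only [Pi.star_apply, Sum.elim_inl, Sum.elim_inr, Pi.add_apply, Matrix.one_mulVec,
    Matrix.neg_mulVec, Pi.neg_apply, Matrix.mulVec_diagonal, Function.comp_apply, blockForm]
  ring

/-- There is an isotropic subspace of dimension at least `k` for the form of `pencilMatrix p q κ`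
in the sum of the blocks with index in `T`. -/
def HasIsotropicSubspaceOn (p q κ : S → ℝ) (T : Finset S) (k : ℕ) : Prop :=
  ∃ W : Submodule ℂ (S ⊕ S → ℂ), k ≤ Module.finrank ℂ W ∧ ∀ x ∈ W,
    (∀ j ∉ T, x (Sum.inl j) = 0 ∧ x (Sum.inr j) = 0) ∧
    ∑ j, blockForm (p j) (q j) (κ j) (x (Sum.inl j)) (x (Sum.inr j)) = 0

lemma HasIsotropicSubspaceOn.union [DecidableEq S] {p q κ : S → ℝ} {T T' : Finset S} {k k' : ℕ}
    (h : HasIsotropicSubspaceOn p q κ T k) (h' : HasIsotropicSubspaceOn p q κ T' k')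
    (hT : Disjoint T T') : HasIsotropicSubspaceOn p q κ (T ∪ T') (k + k') := by
  obtain ⟨W, hk, hW⟩ := h
  obtain ⟨W', hk', hW'⟩ := h'
  refine ⟨W ⊔ W', ?_, ?_⟩
  · have hd : W ⊓ W' = ⊥ := by
      rw [Submodule.eq_bot_iff]
      rintro x ⟨hx, hx'⟩
      have key : ∀ j, x (Sum.inl j) = 0 ∧ x (Sum.inr j) = 0 := by
        intro j
        by_cases hj : j ∈ T
        · exact (hW' x hx').1 j (Finset.disjoint_left.mp hT hj)
        · exact (hW x hx).1 j hj
      ext (j | j)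
      · exact (key j).1
      · exact (key j).2
    have := Submodule.finrank_sup_add_finrank_inf_eq W W'
    rw [hd, finrank_bot] at this
    omega
  · intro x hx
    obtain ⟨y, hy, z, hz, rfl⟩ := Submodule.mem_sup.mp hx
    obtain ⟨hy1, hy2⟩ := hW y hy
    obtain ⟨hz1, hz2⟩ := hW' z hz
    refine ⟨fun j hj => ?_, ?_⟩
    · rw [Finset.mem_union, not_or] at hj
      simp [hy1 j hj.1, hz1 j hj.2]
    · rw [← add_zero (0 : ℂ)]
      nth_rewrite 2 [← hy2]
      rw [← hz2, ← Finset.sum_add_distrib]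
      refine Finset.sum_congr rfl fun j _ => ?_
      by_cases hj : j ∈ T
      · have := hz1 j (Finset.disjoint_left.mp hT hj)
        simp [this, blockForm]
      · have := hy1 j hj
        simp [this, blockForm]

lemma HasIsotropicSubspaceOn.empty (p q κ : S → ℝ) : HasIsotropicSubspaceOn p q κ ∅ 0 :=
  ⟨⊥, by simp, fun x hx => by simp [(Submodule.mem_bot ℂ).mp hx, blockForm]⟩

lemma HasIsotropicSubspaceOn.biUnion [DecidableEq S] {p q κ : S → ℝ} {I : Type*} [DecidableEq I]
    (J : Finset I) (T : I → Finset S) (k : I → ℕ)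
    (h : ∀ i ∈ J, HasIsotropicSubspaceOn p q κ (T i) (k i))
    (hT : ∀ i ∈ J, ∀ j ∈ J, i ≠ j → Disjoint (T i) (T j)) :
    HasIsotropicSubspaceOn p q κ (J.biUnion T) (∑ i ∈ J, k i) := by
  induction J using Finset.induction_on with
  | empty => simpa using HasIsotropicSubspaceOn.empty p q κ
  | insert a J ha ih =>
    rw [Finset.biUnion_insert, Finset.sum_insert ha]
    refine (h a (Finset.mem_insert_self a J)).union
      (ih (fun i hi => h i (Finset.mem_insert_of_mem hi)) fun i hi j hj =>
        hT i (Finset.mem_insert_of_mem hi) j (Finset.mem_insert_of_mem hj)) ?_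
    rw [Finset.disjoint_biUnion_right]
    exact fun i hi => hT a (Finset.mem_insert_self a J) i (Finset.mem_insert_of_mem hi)
      fun h => ha (h ▸ hi)

/-- A block whose discriminant `q ^ 2 - κ ^ 2 p` is not positive has an isotropic vector. -/
lemma hasIsotropicSubspaceOn_singleton {p q κ : S → ℝ} {j : S} (hκ : 0 < κ j)
    (hd : q j ^ 2 ≤ κ j ^ 2 * p j) : HasIsotropicSubspaceOn p q κ {j} 1 := by
  classical
  have hs : 0 ≤ p j - (q j / κ j) ^ 2 := by
    rw [div_pow, sub_nonneg, div_le_iff₀ (by positivity)]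
    linarith
  let a : ℂ := ⟨√(p j - (q j / κ j) ^ 2), q j / κ j⟩
  let v : S ⊕ S → ℂ := Sum.elim (Pi.single j a) (Pi.single j 1)
  have hv : blockForm (p j) (q j) (κ j) a 1 = 0 := by
    have h1 := Real.sq_sqrt hs
    have h2 : κ j * (q j / κ j) = q j := by field_simp
    apply Complex.ext
    · simp [blockForm, a]
      linear_combination h1
    · simp [blockForm, a]
      linear_combination -h2
  refine ⟨ℂ ∙ v, ?_, ?_⟩
  · rw [finrank_span_singleton]
    intro h
    simpa [v] using congrFun h (Sum.inr j)
  · intro x hx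
    obtain ⟨c, rfl⟩ := Submodule.mem_span_singleton.mp hx
    refine ⟨fun i hi => ?_, ?_⟩
    · rw [Finset.mem_singleton] at hi
      simp [v, hi]
    · rw [Finset.sum_eq_single j]
      · have h3 : blockForm (p j) (q j) (κ j) (c * a) (c * 1) =
            star c * c * blockForm (p j) (q j) (κ j) a 1 := by
          simp only [blockForm, star_mul']
          ring
        simpa [v, hv] using h3
      · intro i _ hi
        simp [v, hi, blockForm]
      · simp

/-- The vectors `(-i σ κ / 2, 1)` for the two roots `σ = l, r` of `p + q σ + κ ^ 2 σ ^ 2 / 4`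
diagonalize the form of a block. -/
lemma blockForm_of_roots (l r κ : ℝ) (a b : ℂ) :
    blockForm (l * r * κ ^ 2 / 4) (-(l + r) * κ ^ 2 / 4) κ
      (a * (-Complex.I * l * κ / 2) + b * (-Complex.I * r * κ / 2)) (a + b) =
    κ ^ 2 / 4 * (r - l) * (-(l + Complex.I) * (star a * a) + (r + Complex.I) * (star b * b)) := by
  have hI : Complex.I ^ 2 = -1 := Complex.I_sq
  simp only [blockForm, star_add, star_mul', star_neg, Complex.star_def, Complex.conj_I,
    Complex.conj_ofReal, star_div₀, map_ofNat]
  push_cast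
  linear_combination (-(κ : ℂ) ^ 2 / 4 *
    ((starRingEnd ℂ) a * l + (starRingEnd ℂ) b * r) * (a * l + b * r)) * hI

open Polynomial in
/-- Blocks of positive discriminant whose root intervals `[l j, r j]` are pairwise disjoint: the
Lagrange weights `∏ (t_a - t_b)⁻¹` of the endpoints are negative at left and positive at right
endpoints, like the signs with which the numbers `t + i` occur in the diagonalized form. Hence
the values of a polynomial `P` of degree less than `#T - 1`, suitably weighted, are an isotropic
vector, for the value of the form is the coefficient of degree `2 #T - 1` of
`(X + i) P \bar P`. -/
lemma hasIsotropicSubspaceOn_of_disjoint_intervals {p q κ : S → ℝ} (l r : S → ℝ) (T : Finset S)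
    (hκ : ∀ j ∈ T, 0 < κ j) (hlr : ∀ j ∈ T, l j < r j)
    (hp : ∀ j ∈ T, p j = l j * r j * κ j ^ 2 / 4)
    (hq : ∀ j ∈ T, q j = -(l j + r j) * κ j ^ 2 / 4)
    (hT : ∀ i ∈ T, ∀ j ∈ T, i ≠ j → r i < l j ∨ r j < l i) :
    HasIsotropicSubspaceOn p q κ T (T.card - 1) := by
  classical
  let t : S ⊕ S → ℝ := Sum.elim l r
  let s : Finset (S ⊕ S) := T.disjSum T
  let D : S ⊕ S → ℝ := fun a => ∏ b ∈ s.erase a, (t a - t b)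
  have hDl : ∀ j ∈ T, D (Sum.inl j) < 0 := by
    intro j hj
    have h1 : s.erase (Sum.inl j) = (T.erase j).disjSum T := by
      ext (i | i) <;> simp [s]
    simp only [D, h1, Finset.prod_disjSum, t, Sum.elim_inl, Sum.elim_inr]
    rw [← Finset.mul_prod_erase T (fun i => l j - r i) hj, mul_left_comm, ← Finset.prod_mul_distrib]
    refine mul_neg_of_neg_of_pos (sub_neg.mpr (hlr j hj)) (Finset.prod_pos fun i hi => ?_)
    obtain ⟨hij, hi⟩ := Finset.mem_erase.mp hi
    have := hlr i hi
    have := hlr j hj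
    rcases hT i hi j hj hij with h | h
    · exact mul_pos (by linarith) (by linarith)
    · exact mul_pos_of_neg_of_neg (by linarith) (by linarith)
  have hDr : ∀ j ∈ T, 0 < D (Sum.inr j) := by
    intro j hj
    have h1 : s.erase (Sum.inr j) = T.disjSum (T.erase j) := by
      ext (i | i) <;> simp [s]
    simp only [D, h1, Finset.prod_disjSum, t, Sum.elim_inl, Sum.elim_inr]
    rw [← Finset.mul_prod_erase T (fun i => r j - l i) hj, mul_assoc, ← Finset.prod_mul_distrib]
    refine mul_pos (sub_pos.mpr (hlr j hj)) (Finset.prod_pos fun i hi => ?_)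
    obtain ⟨hij, hi⟩ := Finset.mem_erase.mp hi
    have := hlr i hi
    have := hlr j hj
    rcases hT i hi j hj hij with h | h
    · exact mul_pos (by linarith) (by linarith)
    · exact mul_pos_of_neg_of_neg (by linarith) (by linarith)
  have ht : Set.InjOn (fun a => (t a : ℂ)) s := by
    intro a ha b hb hab
    by_contra hne
    have hab' : t a = t b := Complex.ofReal_injective hab
    have h0 : D a = 0 := Finset.prod_eq_zero (i := b)
      (Finset.mem_erase.mpr ⟨fun h => hne h.symm, hb⟩) (by rw [hab', sub_self])
    rcases a with j | j
    · exact (hDl j (by simpa [s] using ha)).ne h0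
    · exact (hDr j (by simpa [s] using ha)).ne' h0
  let w : S → ℝ := fun j => κ j ^ 2 / 4 * (r j - l j)
  have hw : ∀ j ∈ T, 0 < w j := fun j hj =>
    mul_pos (by have := hκ j hj; positivity) (sub_pos.mpr (hlr j hj))
  let α : S → ℝ := fun j => √(-(w j * D (Sum.inl j))⁻¹)
  let β : S → ℝ := fun j => √((w j * D (Sum.inr j))⁻¹)
  have hα0 : ∀ j ∈ T, 0 < -(w j * D (Sum.inl j))⁻¹ := fun j hj => by
    rw [← inv_neg, inv_pos, neg_pos]
    exact mul_neg_of_pos_of_neg (hw j hj) (hDl j hj)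
  have hβ0 : ∀ j ∈ T, 0 < (w j * D (Sum.inr j))⁻¹ := fun j hj =>
    inv_pos.mpr (mul_pos (hw j hj) (hDr j hj))
  have hα : ∀ j ∈ T, w j * α j ^ 2 = -(D (Sum.inl j))⁻¹ := fun j hj => by
    rw [Real.sq_sqrt (hα0 j hj).le, mul_inv]
    have := (hw j hj).ne'
    field_simp
  have hβ : ∀ j ∈ T, w j * β j ^ 2 = (D (Sum.inr j))⁻¹ := fun j hj => by
    rw [Real.sq_sqrt (hβ0 j hj).le, mul_inv]
    have := (hw j hj).ne'
    field_simp
  let Φ : ℂ[X] →ₗ[ℂ] (S ⊕ S → ℂ) := LinearMap.pi (Sum.elim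
    (fun j => if j ∈ T then
        (α j * (-Complex.I * l j * κ j / 2)) • Polynomial.leval (l j : ℂ) +
        (β j * (-Complex.I * r j * κ j / 2)) • Polynomial.leval (r j : ℂ) else 0)
    (fun j => if j ∈ T then
        (α j : ℂ) • Polynomial.leval (l j : ℂ) + (β j : ℂ) • Polynomial.leval (r j : ℂ) else 0))
  have hΦl : ∀ P, ∀ j ∈ T, Φ P (Sum.inl j) =
      (α j * P.eval (l j : ℂ)) * (-Complex.I * l j * κ j / 2) +
      (β j * P.eval (r j : ℂ)) * (-Complex.I * r j * κ j / 2) := by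
    intro P j hj
    simp [Φ, hj, Polynomial.leval]
    ring
  have hΦr : ∀ P, ∀ j ∈ T, Φ P (Sum.inr j) =
      (α j * P.eval (l j : ℂ)) + (β j * P.eval (r j : ℂ)) := by
    intro P j hj
    simp [Φ, hj, Polynomial.leval]
  have hΦ0 : ∀ P, ∀ j ∉ T, Φ P (Sum.inl j) = 0 ∧ Φ P (Sum.inr j) = 0 := by
    intro P j hj
    simp [Φ, hj]
  let n := T.card - 1
  let Ψ : Polynomial.degreeLT ℂ n →ₗ[ℂ] (S ⊕ S → ℂ) := Φ.comp (Polynomial.degreeLT ℂ n).subtype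
  have hΨ : Function.Injective Ψ := by
    rw [← LinearMap.ker_eq_bot, LinearMap.ker_eq_bot']
    rintro ⟨P, hP⟩ h0
    replace h0 : Φ P = 0 := h0
    have hroot : ∀ j ∈ T, P.eval (l j : ℂ) = 0 := by
      intro j hj
      have h1 := hΦl P j hj
      have h2 := hΦr P j hj
      rw [h0, Pi.zero_apply] at h1 h2
      have h3 : (r j - l j : ℂ) * (Complex.I * κ j / 2 * α j) * P.eval (l j : ℂ) = 0 := by
        linear_combination -h1 - (Complex.I * r j * κ j / 2) * h2
      have h4 : (r j - l j : ℂ) ≠ 0 := by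
        exact_mod_cast (sub_pos.mpr (hlr j hj)).ne'
      have h5 : (α j : ℂ) ≠ 0 := by
        exact_mod_cast (Real.sqrt_pos.mpr (hα0 j hj)).ne'
      have h6 : (κ j : ℂ) ≠ 0 := by exact_mod_cast (hκ j hj).ne'
      simpa [h4, h5, h6] using h3
    have hinj : Set.InjOn (fun j => (l j : ℂ)) T := by
      intro i hi j hj hij
      have hi' : Sum.inl i ∈ s := by simpa [s] using hi
      have hj' : Sum.inl j ∈ s := by simpa [s] using hj
      exact Sum.inl_injective (ht hi' hj' (by simpa [t] using hij))
    have hdeg : P.degree < T.card :=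
      (Polynomial.mem_degreeLT.mp hP).trans_le (by exact_mod_cast Nat.sub_le _ _)
    exact Subtype.ext (Polynomial.eq_zero_of_degree_lt_of_eval_index_eq_zero _ hinj hdeg hroot)
  refine ⟨LinearMap.range Ψ, ?_, ?_⟩
  · rw [LinearMap.finrank_range_of_inj hΨ, (Polynomial.degreeLTEquiv ℂ n).finrank_eq]
    simp [n]
  · rintro _ ⟨⟨P, hP⟩, rfl⟩
    refine ⟨hΦ0 P, ?_⟩
    change ∑ j, blockForm (p j) (q j) (κ j) (Φ P (Sum.inl j)) (Φ P (Sum.inr j)) = 0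
    by_cases hn : n = 0
    · have hP0 : P = 0 := by
        rw [Polynomial.mem_degreeLT, hn] at hP
        simpa using hP
      simp [hP0, blockForm]
    let Q : ℂ[X] := (X + Polynomial.C Complex.I) * (P * P.map (starRingEnd ℂ))
    have hQeval : ∀ x : ℝ, Q.eval (x : ℂ) =
        (x + Complex.I) * (star (P.eval (x : ℂ)) * P.eval (x : ℂ)) := by
      intro x
      have : (P.map (starRingEnd ℂ)).eval (x : ℂ) = star (P.eval (x : ℂ)) := by
        have := Polynomial.eval_map_apply (f := starRingEnd ℂ) (p := P) (x : ℂ)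
        simpa using this
      simp only [Q, eval_mul, eval_add, eval_X, eval_C, this]
      ring
    have hscard : s.card = 2 * T.card := by
      simp [s, Finset.card_disjSum, two_mul]
    have hQdeg : Q.natDegree < s.card - 1 := by
      have h1 : P.natDegree < n := by
        rw [Polynomial.mem_degreeLT] at hP
        by_cases hP0 : P = 0
        · simp [hP0]; omega
        · exact (Polynomial.natDegree_lt_iff_degree_lt hP0).mpr hP
      have h2 : Q.natDegree ≤ 1 + (P.natDegree + P.natDegree) := by
        refine Polynomial.natDegree_mul_le.trans (add_le_add (by compute_degree) ?_)
        exact Polynomial.natDegree_mul_le.trans (add_le_add le_rfl Polynomial.natDegree_map_le)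
      omega
    have key := Lagrange.coeff_eq_sum ht (P := Q) (by
      refine Polynomial.degree_le_natDegree.trans_lt ?_
      exact_mod_cast (hQdeg.trans_le (Nat.sub_le _ _)))
    rw [Polynomial.coeff_eq_zero_of_natDegree_lt hQdeg] at key
    rw [← Finset.sum_subset (Finset.subset_univ T) (fun j _ hj => by
      simp [hΦ0 P j hj, blockForm]), key, Finset.sum_disjSum, ← Finset.sum_add_distrib]
    refine Finset.sum_congr rfl fun j hj => ?_
    have hDl' : ∏ b ∈ s.erase (Sum.inl j), ((t (Sum.inl j) : ℂ) - t b) = (D (Sum.inl j) : ℂ) := by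
      simp [D]
    have hDr' : ∏ b ∈ s.erase (Sum.inr j), ((t (Sum.inr j) : ℂ) - t b) = (D (Sum.inr j) : ℂ) := by
      simp [D]
    have hα' : (w j * α j ^ 2 : ℂ) = -(D (Sum.inl j) : ℂ)⁻¹ := by exact_mod_cast hα j hj
    have hβ' : (w j * β j ^ 2 : ℂ) = (D (Sum.inr j) : ℂ)⁻¹ := by exact_mod_cast hβ j hj
    rw [hp j hj, hq j hj, hΦl P j hj, hΦr P j hj, blockForm_of_roots, hDl', hDr', hQeval, hQeval]
    have hw' : (κ j : ℂ) ^ 2 / 4 * (r j - l j) = w j := by simp [w]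
    rw [hw']
    simp only [t, Sum.elim_inl, Sum.elim_inr, div_eq_mul_inv, ← hβ', star_mul', Complex.star_def,
      Complex.conj_ofReal]
    rw [show (D (Sum.inl j) : ℂ)⁻¹ = -(w j * α j ^ 2 : ℂ) by rw [hα', neg_neg]]
    ring

/-- The case of strict inequalities of `hasIsotropicSubspace_pencilMatrix`. The blocks whose root
intervals have the same colour lose one dimension together, so that at most `g` dimensions are
lost. -/
lemma hasIsotropicSubspace_pencilMatrix_of_pos [DecidableEq S] {p q κ : S → ℝ}
    (hκ : ∀ j, 0 < κ j) (g : ℕ) (h : ∀ σ : ℝ, (Finset.univ.filter fun j =>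
      p j + q j * σ + κ j ^ 2 * σ ^ 2 / 4 ≤ 0).card ≤ g) :
    HasIsotropicSubspace (pencilMatrix p q κ) (Fintype.card S - g) := by
  let d : S → ℝ := fun j => √(q j ^ 2 - κ j ^ 2 * p j)
  let l : S → ℝ := fun j => (-q j - d j) * 2 / κ j ^ 2
  let r : S → ℝ := fun j => (-q j + d j) * 2 / κ j ^ 2
  let G : Finset S := Finset.univ.filter fun j => κ j ^ 2 * p j < q j ^ 2
  have hd : ∀ j ∈ G, d j ^ 2 = q j ^ 2 - κ j ^ 2 * p j := fun j hj =>
    Real.sq_sqrt (by have := (Finset.mem_filter.mp hj).2; linarith)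
  have hlr : ∀ j, l j ≤ r j := fun j => by
    have := Real.sqrt_nonneg (q j ^ 2 - κ j ^ 2 * p j)
    have := hκ j
    simp only [l, r]
    gcongr
    simp only [d]
    linarith
  have hlr' : ∀ j ∈ G, l j < r j := fun j hj => by
    have : 0 < d j := Real.sqrt_pos.mpr (by have := (Finset.mem_filter.mp hj).2; linarith)
    have := hκ j
    simp only [l, r]
    gcongr
    linarith
  have hp : ∀ j ∈ G, p j = l j * r j * κ j ^ 2 / 4 := fun j hj => by
    have h1 := hd j hj
    have h2 := (hκ j).ne'
    simp only [l, r]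
    field_simp
    linear_combination 4 * h1
  have hq : ∀ j ∈ G, q j = -(l j + r j) * κ j ^ 2 / 4 := fun j hj => by
    have h2 := (hκ j).ne'
    simp only [l, r]
    field_simp
    ring
  obtain ⟨c, hc, hdisj⟩ := exists_coloring_of_intervals l r hlr g G fun σ => by
    refine (Finset.card_le_card fun j hj => ?_).trans (h σ)
    obtain ⟨hj, h1, h2⟩ := Finset.mem_filter.mp hj
    refine Finset.mem_filter.mpr ⟨Finset.mem_univ j, ?_⟩
    have h3 : p j + q j * σ + κ j ^ 2 * σ ^ 2 / 4 = -(κ j ^ 2 / 4 * ((σ - l j) * (r j - σ))) := by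
      rw [hp j hj]
      nth_rewrite 1 [hq j hj]
      ring
    rw [h3, neg_nonpos]
    exact mul_nonneg (by positivity) (mul_nonneg (by linarith) (by linarith))
  let T : ℕ → Finset S := fun i => G.filter fun j => c j = i
  have h1 : HasIsotropicSubspaceOn p q κ ((Finset.range g).biUnion T)
      (∑ i ∈ Finset.range g, ((T i).card - 1)) := by
    refine HasIsotropicSubspaceOn.biUnion _ _ _ (fun i _ => ?_) fun i _ i' _ hne => ?_
    · refine hasIsotropicSubspaceOn_of_disjoint_intervals l r (T i) (fun j _ => hκ j)
        (fun j hj => hlr' j (Finset.mem_filter.mp hj).1)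
        (fun j hj => hp j (Finset.mem_filter.mp hj).1)
        (fun j hj => hq j (Finset.mem_filter.mp hj).1) fun j hj j' hj' hne => ?_
      obtain ⟨hj, hcj⟩ := Finset.mem_filter.mp hj
      obtain ⟨hj', hcj'⟩ := Finset.mem_filter.mp hj'
      exact hdisj j hj j' hj' hne (hcj.trans hcj'.symm)
    · refine Finset.disjoint_left.mpr fun j hj hj' => hne ?_
      rw [← (Finset.mem_filter.mp hj).2, ← (Finset.mem_filter.mp hj').2]
  have h2 : HasIsotropicSubspaceOn p q κ (Gᶜ.biUnion fun j => {j}) (∑ _j ∈ Gᶜ, 1) := by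
    refine HasIsotropicSubspaceOn.biUnion _ _ _ (fun j hj => ?_) fun i _ j _ hij => by
      simpa using hij
    exact hasIsotropicSubspaceOn_singleton (hκ j) (by simpa [G] using hj)
  have hU : (Finset.range g).biUnion T = G := by
    ext j
    simp only [Finset.mem_biUnion, Finset.mem_range, T, Finset.mem_filter]
    exact ⟨fun ⟨_, _, hj, _⟩ => hj, fun hj => ⟨c j, hc j hj, hj, rfl⟩⟩
  rw [hU] at h1
  rw [Finset.biUnion_singleton_eq_self] at h2
  obtain ⟨W, hW, hiso⟩ := h1.union h2 disjoint_compl_right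
  refine ⟨W, le_trans ?_ hW, fun x hx => ?_⟩
  · have hcardG : G.card ≤ (∑ i ∈ Finset.range g, ((T i).card - 1)) + g := by
      rw [← hU, Finset.card_biUnion (fun i _ i' _ hne => Finset.disjoint_left.mpr
        fun j hj hj' => hne (by
          rw [← (Finset.mem_filter.mp hj).2, ← (Finset.mem_filter.mp hj').2]))]
      calc ∑ i ∈ Finset.range g, (T i).card ≤ ∑ i ∈ Finset.range g, (((T i).card - 1) + 1) :=
            Finset.sum_le_sum fun i _ => by omega
        _ = _ := by simp [Finset.sum_add_distrib]
    have := Finset.card_add_card_compl G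
    simp only [Finset.sum_const, smul_eq_mul, mul_one]
    omega
  · rw [star_dotProduct_pencilMatrix_mulVec]
    exact (hiso x hx).2

/-- If for every real `σ` at most `g` of the Hermitian matrices `Re B_j - σ Im B_j` of the blocks
`B_j = [[1, κ j / 2], [-κ j / 2, -p j + i q j]]` are positive definite, then the direct sum of the
blocks has an isotropic subspace of dimension `#S - g`. -/
lemma hasIsotropicSubspace_pencilMatrix [DecidableEq S] {p q κ : S → ℝ} (hκ : ∀ j, 0 ≤ κ j) (g : ℕ)
    (h : ∀ σ : ℝ, (Finset.univ.filter fun j =>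
      p j + q j * σ + κ j ^ 2 * σ ^ 2 / 4 < 0).card ≤ g) :
    HasIsotropicSubspace (pencilMatrix p q κ) (Fintype.card S - g) := by
  -- Enlarging `p` and `κ ^ 2` turns the strict inequality into a non-strict one; let `ε → 0`.
  let M : ℝ → Matrix (S ⊕ S) (S ⊕ S) ℂ := fun ε =>
    pencilMatrix (fun j => p j + ε) q (fun j => √(κ j ^ 2 + ε))
  have hM : Continuous M := by
    simp only [M, pencilMatrix]
    refine Continuous.matrix_fromBlocks continuous_const ?_ ?_ ?_ <;> fun_prop
  have hM0 : M 0 = pencilMatrix p q κ := by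
    simp [M, Real.sqrt_sq (hκ _)]
  rw [← hM0]
  refine (isClosed_setOf_hasIsotropicSubspace (Fintype.card S - g)).mem_of_tendsto
    ((hM.tendsto 0).mono_left (nhdsWithin_le_nhds (s := Set.Ioi 0))) ?_
  filter_upwards [self_mem_nhdsWithin] with ε hε
  have hε : 0 < ε := hε
  refine hasIsotropicSubspace_pencilMatrix_of_pos (fun j => by positivity) g fun σ =>
    (Finset.card_le_card fun j hj => ?_).trans (h σ)
  obtain ⟨hj, h1⟩ := Finset.mem_filter.mp hj
  refine Finset.mem_filter.mpr ⟨hj, ?_⟩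
  rw [Real.sq_sqrt (by positivity)] at h1
  nlinarith [mul_nonneg hε.le (sq_nonneg σ)]

end Pencil

/-! ### Convex hulls of compact sets -/

/-- By Carathéodory's theorem the convex hull of a compact set is the image of a compact set. -/
lemma isCompact_convexHull {E : Type*} [NormedAddCommGroup E] [NormedSpace ℝ E]
    [FiniteDimensional ℝ E] {s : Set E} (hs : IsCompact s) : IsCompact (convexHull ℝ s) := by
  rcases s.eq_empty_or_nonempty with rfl | ⟨x₀, hx₀⟩
  · simp
  let n := Module.finrank ℝ E + 1
  let f : (Fin n → ℝ) × (Fin n → E) → E := fun p => ∑ i, p.1 i • p.2 i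
  have hf : Continuous f := by fun_prop
  suffices h : convexHull ℝ s = f '' (stdSimplex ℝ (Fin n) ×ˢ Set.univ.pi fun _ => s) by
    rw [h]
    exact ((isCompact_stdSimplex ℝ (Fin n)).prod (isCompact_univ_pi fun _ => hs)).image hf
  ext x
  constructor
  · intro hx
    obtain ⟨ι, _, z, w, hz, hind, hw, hw1, hx⟩ := eq_pos_convex_span_of_mem_convexHull hx
    obtain ⟨e⟩ := Function.Embedding.nonempty_of_card_le (α := ι) (β := Fin n) (by
      have h1 := hind.card_le_finrank_succ
      have h2 := Submodule.finrank_le (vectorSpan ℝ (Set.range z))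
      rw [Fintype.card_fin]
      omega)
    refine ⟨(Function.extend e w 0, Function.extend e z fun _ => x₀), ⟨⟨fun i => ?_, ?_⟩, ?_⟩, ?_⟩
    · by_cases hi : ∃ j, e j = i
      · obtain ⟨j, rfl⟩ := hi
        simpa only [e.injective.extend_apply] using (hw j).le
      · simp only [Function.extend_apply' _ _ _ hi, Pi.zero_apply, le_refl]
    · rw [← hw1]
      refine (Fintype.sum_of_injective e e.injective _ _ (fun i hi => ?_) fun i => ?_).symm
      · exact Function.extend_apply' _ _ _ hi
      · exact (e.injective.extend_apply _ _ _).symm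
    · intro i _
      by_cases hi : ∃ j, e j = i
      · obtain ⟨j, rfl⟩ := hi
        simp only [e.injective.extend_apply]
        exact hz (Set.mem_range_self j)
      · simp only [Function.extend_apply' _ _ _ hi]
        exact hx₀
    · rw [← hx]
      refine (Fintype.sum_of_injective e e.injective _ _ (fun i hi => ?_) fun i => ?_).symm
      · simp only [Function.extend_apply' _ _ _ hi, Pi.zero_apply, zero_smul]
      · simp only [e.injective.extend_apply]
  · rintro ⟨⟨w, z⟩, ⟨⟨hw, hw1⟩, hz⟩, rfl⟩
    exact (convex_convexHull ℝ s).sum_mem (fun i _ => hw i) hw1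
      fun i _ => subset_convexHull ℝ s (hz i (Set.mem_univ i))

/-! ### Support functions of ellipses -/

section Ellipse

/-- The quadric `k |w|² - 2 Re (w² \bar D) = (k² - 4 |D|²) / 4`, for `D = ρ²`, is the ellipse with
foci `±ρ` and major axis of length `√(k + 2 |D|)`. -/
lemma norm_sub_add_norm_add_eq_iff {ρ w : ℂ} {k : ℝ} (hk : 2 * ‖ρ‖ ^ 2 < k) :
    ‖w - ρ‖ + ‖w + ρ‖ = √(k + 2 * ‖ρ‖ ^ 2) ↔
      k * ‖w‖ ^ 2 - 2 * (w ^ 2 * star (ρ ^ 2)).re = (k ^ 2 - 4 * ‖ρ‖ ^ 4) / 4 := by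
  have hs : ‖w - ρ‖ ^ 2 + ‖w + ρ‖ ^ 2 = 2 * (‖w‖ ^ 2 + ‖ρ‖ ^ 2) := by
    simp only [Complex.sq_norm, Complex.normSq_apply, Complex.sub_re, Complex.sub_im,
      Complex.add_re, Complex.add_im]
    ring
  have hp : (‖w - ρ‖ * ‖w + ρ‖) ^ 2 =
      ‖w‖ ^ 4 + ‖ρ‖ ^ 4 - 2 * (w ^ 2 * star (ρ ^ 2)).re := by
    rw [mul_pow, show ‖w‖ ^ 4 = (‖w‖ ^ 2) ^ 2 by ring, show ‖ρ‖ ^ 4 = (‖ρ‖ ^ 2) ^ 2 by ring]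
    simp only [Complex.sq_norm, Complex.normSq_apply]
    simp only [Complex.sub_re, Complex.sub_im, Complex.add_re, Complex.add_im, Complex.star_def,
      Complex.mul_re, pow_two, Complex.mul_im, Complex.conj_re, Complex.conj_im]
    ring
  have hcs : (w ^ 2 * star (ρ ^ 2)).re ≤ ‖w‖ ^ 2 * ‖ρ‖ ^ 2 := by
    refine (Complex.re_le_norm _).trans ?_
    rw [norm_mul, norm_star, norm_pow, norm_pow]
  have hpos : 0 ≤ ‖w - ρ‖ * ‖w + ρ‖ := by positivity
  have hρ := sq_nonneg ‖ρ‖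
  rw [eq_comm, Real.sqrt_eq_iff_mul_self_eq (by linarith) (by positivity)]
  generalize ‖w - ρ‖ = s at *
  generalize ‖w + ρ‖ = t at *
  have hsq : (s + t) * (s + t) = 2 * (‖w‖ ^ 2 + ‖ρ‖ ^ 2) + 2 * (s * t) := by
    linear_combination hs
  rw [hsq]
  constructor
  · intro h
    have h1 : s * t = (k + 2 * ‖ρ‖ ^ 2) / 2 - (‖w‖ ^ 2 + ‖ρ‖ ^ 2) := by linarith
    rw [h1] at hp
    linear_combination -hp
  · intro h
    have hw : ‖w‖ ^ 2 ≤ (k + 2 * ‖ρ‖ ^ 2) / 4 := by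
      have h2 : (k - 2 * ‖ρ‖ ^ 2) * ‖w‖ ^ 2 ≤ (k - 2 * ‖ρ‖ ^ 2) * ((k + 2 * ‖ρ‖ ^ 2) / 4) := by
        nlinarith
      exact le_of_mul_le_mul_left h2 (by linarith)
    have h1 : s * t = (k + 2 * ‖ρ‖ ^ 2) / 2 - (‖w‖ ^ 2 + ‖ρ‖ ^ 2) := by
      rw [← sq_eq_sq₀ hpos (by linarith)]
      linear_combination hp + h
    linarith

/-- The ellipse with centre `c`, foci `c ± ρ` and axes of lengths `√(k + 2 |ρ|²)` and
`√(k - 2 |ρ|²)`; it is the pair of its foci if the minor axis vanishes. -/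
noncomputable def ellipse (c ρ : ℂ) (k : ℝ) : Set ℂ :=
  open scoped Classical in
  if 2 * ‖ρ‖ ^ 2 < k then {w | dist w (c + ρ) + dist w (c - ρ) = √(k + 2 * ‖ρ‖ ^ 2)}
  else {c + ρ, c - ρ}

lemma mem_ellipse_iff {c ρ w : ℂ} {k : ℝ} (hk : 2 * ‖ρ‖ ^ 2 < k) :
    w ∈ ellipse c ρ k ↔
      k * ‖w - c‖ ^ 2 - 2 * ((w - c) ^ 2 * star (ρ ^ 2)).re = (k ^ 2 - 4 * ‖ρ‖ ^ 4) / 4 := by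
  rw [← norm_sub_add_norm_add_eq_iff hk, ellipse, if_pos hk, Set.mem_ofPred_eq, dist_eq_norm,
    dist_eq_norm]
  congr! 3 <;> ring_nf

lemma isCompact_ellipse (c ρ : ℂ) (k : ℝ) : IsCompact (ellipse c ρ k) := by
  unfold ellipse
  split_ifs with h
  · refine (isCompact_closedBall (c + ρ) (√(k + 2 * ‖ρ‖ ^ 2))).of_isClosed_subset
      (isClosed_eq (by fun_prop) continuous_const) fun w hw => ?_
    rw [Metric.mem_closedBall, ← show _ = √(k + 2 * ‖ρ‖ ^ 2) from hw]
    exact le_add_of_nonneg_right dist_nonneg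
  · exact (Set.toFinite _).isCompact

/-- Four times the square of the support function of `ellipse c ρ k` about its centre, in the
direction of `\bar ω`. -/
noncomputable def supportSq (ρ : ℂ) (k : ℝ) (ω : ℂ) : ℝ := k * ‖ω‖ ^ 2 + 2 * (ω ^ 2 * ρ ^ 2).re

lemma supportSq_eq_sq (ρ ω : ℂ) : supportSq ρ (2 * ‖ρ‖ ^ 2) ω = (2 * (ω * ρ).re) ^ 2 := by
  simp only [supportSq, Complex.sq_norm, Complex.normSq_apply]
  simp only [Complex.mul_re, pow_two, Complex.mul_im]
  ring

lemma le_supportSq (ρ ω : ℂ) (k : ℝ) : (k - 2 * ‖ρ‖ ^ 2) * ‖ω‖ ^ 2 ≤ supportSq ρ k ω := by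
  have h1 := abs_le.mp (Complex.abs_re_le_norm (ω ^ 2 * ρ ^ 2))
  rw [norm_mul, norm_pow, norm_pow] at h1
  rw [supportSq]
  linarith [h1.1]

/-- The ellipse lies in the half-plane given by its support function. -/
lemma re_mul_sub_le_of_mem_ellipse {c ρ w : ℂ} {k : ℝ} (hk : 2 * ‖ρ‖ ^ 2 ≤ k)
    (hw : w ∈ ellipse c ρ k) (ω : ℂ) : (ω * (w - c)).re ≤ √(supportSq ρ k ω) / 2 := by
  suffices h : (2 * (ω * (w - c)).re) ^ 2 ≤ supportSq ρ k ω by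
    have := (le_abs_self _).trans (Real.abs_le_sqrt h)
    linarith
  rcases hk.lt_or_eq with hk' | rfl
  · rw [mem_ellipse_iff hk'] at hw
    have hN : 0 < k ^ 2 - 4 * ‖ρ‖ ^ 4 := by
      have := sq_nonneg ‖ρ‖
      nlinarith
    generalize w - c = v at *
    -- Lagrange's identity for the form `supportSq`
    have hid : supportSq ρ k ω * (k * ‖v‖ ^ 2 - 2 * (v ^ 2 * star (ρ ^ 2)).re) =
        (k ^ 2 - 4 * ‖ρ‖ ^ 4) * (ω * v).re ^ 2 +
          (-k * (ω * v).im + 2 * (ρ ^ 2 * ω * star v).im) ^ 2 := by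
      rw [supportSq, show ‖ρ‖ ^ 4 = (‖ρ‖ ^ 2) ^ 2 by ring]
      simp only [Complex.sq_norm, Complex.normSq_apply]
      simp only [Complex.star_def, Complex.mul_re, pow_two, Complex.mul_im, Complex.conj_re,
        Complex.conj_im]
      ring
    rw [hw] at hid
    have := sq_nonneg (-k * (ω * v).im + 2 * (ρ ^ 2 * ω * star v).im)
    refine le_of_mul_le_mul_left ?_ hN
    linarith
  · rw [ellipse, if_neg (lt_irrefl _)] at hw
    rw [supportSq_eq_sq]
    rcases hw with rfl | rfl
    · simp
    · have : c - ρ - c = -ρ := by ring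
      simp only [this, mul_neg, Complex.neg_re, neg_sq, le_refl]

/-- The support function of the ellipse is attained. -/
lemma exists_mem_ellipse_re_mul_sub_eq {c ρ : ℂ} {k : ℝ} (hk : 2 * ‖ρ‖ ^ 2 ≤ k) (ω : ℂ) :
    ∃ w ∈ ellipse c ρ k, (ω * (w - c)).re = √(supportSq ρ k ω) / 2 := by
  rcases hk.lt_or_eq with hk' | rfl
  · -- for `ω ≠ 0` the point of contact is proportional to the gradient of the support function
    have key : ∀ ω : ℂ, ω ≠ 0 →
        ∃ w ∈ ellipse c ρ k, (ω * (w - c)).re = √(supportSq ρ k ω) / 2 := by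
      intro ω hω
      have hpos : 0 < supportSq ρ k ω :=
        (mul_pos (sub_pos.mpr hk') (by positivity)).trans_le (le_supportSq ρ ω k)
      have hs := Real.sq_sqrt hpos.le
      have hs0 := Real.sqrt_pos.mpr hpos
      generalize √(supportSq ρ k ω) = s at *
      refine ⟨c + (k * star ω + 2 * (ρ ^ 2 * ω)) / (2 * s : ℝ), ?_, ?_⟩
      · rw [mem_ellipse_iff hk', add_sub_cancel_left, norm_div, div_pow, div_pow, Complex.norm_real,
          Real.norm_eq_abs, sq_abs, ← Complex.ofReal_pow, div_mul_eq_mul_div, Complex.div_ofReal_re,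
          mul_pow, hs]
        field_simp
        rw [supportSq, show ‖ρ‖ ^ 4 = (‖ρ‖ ^ 2) ^ 2 by ring]
        simp only [Complex.sq_norm, Complex.normSq_apply]
        simp only [Complex.star_def, map_mul, Complex.mul_re, pow_two, Complex.mul_im,
          Complex.conj_re, Complex.conj_im, Complex.add_re, Complex.add_im, Complex.ofReal_re,
          Complex.ofReal_im, Complex.re_ofNat, Complex.im_ofNat]
        ring
      · rw [add_sub_cancel_left, ← mul_div_assoc, Complex.div_ofReal_re]
        have : (ω * (k * star ω + 2 * (ρ ^ 2 * ω))).re = s ^ 2 := by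
          rw [hs, supportSq]
          simp only [Complex.sq_norm, Complex.normSq_apply]
          simp only [Complex.star_def, Complex.mul_re, pow_two, Complex.mul_im,
            Complex.conj_re, Complex.conj_im, Complex.add_re, Complex.add_im, Complex.ofReal_re,
            Complex.ofReal_im, Complex.re_ofNat, Complex.im_ofNat]
          ring
        rw [this]
        field_simp
    by_cases hω : ω = 0
    · obtain ⟨w, hw, -⟩ := key 1 one_ne_zero
      exact ⟨w, hw, by simp [hω, supportSq]⟩
    · exact key ω hω
  · rw [ellipse, if_neg (lt_irrefl _), supportSq_eq_sq, Real.sqrt_sq_eq_abs]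
    rcases le_total 0 (2 * (ω * ρ).re) with h | h
    · refine ⟨c + ρ, by simp, ?_⟩
      rw [abs_of_nonneg h, add_sub_cancel_left]
      ring
    · refine ⟨c - ρ, by simp, ?_⟩
      rw [abs_of_nonpos h, show c - ρ - c = -ρ by ring, mul_neg, Complex.neg_re]
      ring

end Ellipse

/-! ### The ellipses of the joint eigenvalues -/

section TwoByTwo

/-- Half the length of the segment between the foci, as a complex number. -/
noncomputable def halfFocal (α β z : ℂ) : ℂ := discr α β z ^ (1 / 2 : ℂ) / 2

lemma halfFocal_sq (α β z : ℂ) : halfFocal α β z ^ 2 = discr α β z / 4 := by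
  rw [halfFocal, div_pow, ← Complex.cpow_nat_mul]
  norm_num

lemma norm_halfFocal_sq (α β z : ℂ) : ‖halfFocal α β z‖ ^ 2 = ‖discr α β z‖ / 4 := by
  rw [← norm_pow, halfFocal_sq, norm_div]
  norm_num

/-- The ellipse with foci `focusPlus α β z`, `focusMinus α β z` and squared axes `majorSq α β z h`,
`minorSq α β z h`. -/
noncomputable def ellipseOf (α β z : ℂ) (h : ℝ) : Set ℂ :=
  ellipse ((α + β) / 2) (halfFocal α β z) (‖α - β‖ ^ 2 / 2 + h)

lemma majorSq_eq (α β z : ℂ) (h : ℝ) :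
    majorSq α β z h = (‖α - β‖ ^ 2 / 2 + h) + 2 * ‖halfFocal α β z‖ ^ 2 := by
  rw [norm_halfFocal_sq, majorSq]
  ring

lemma minorSq_eq (α β z : ℂ) (h : ℝ) :
    minorSq α β z h = (‖α - β‖ ^ 2 / 2 + h) - 2 * ‖halfFocal α β z‖ ^ 2 := by
  rw [norm_halfFocal_sq, minorSq]
  ring

lemma majorSq_nonneg {α β z : ℂ} {h : ℝ} (hz : 2 * ‖z‖ ≤ h) : 0 ≤ majorSq α β z h := by
  have := norm_nonneg z
  have : 0 ≤ h := by linarith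
  unfold majorSq
  positivity

lemma minorSq_nonneg {α β z : ℂ} {h : ℝ} (hz : 2 * ‖z‖ ≤ h) : 0 ≤ minorSq α β z h := by
  have h1 : ‖discr α β z‖ ≤ ‖α - β‖ ^ 2 + 4 * ‖z‖ := by
    refine (norm_add_le _ _).trans_eq ?_
    rw [norm_pow, norm_mul]
    norm_num
  unfold minorSq
  linarith

lemma majorSq_eq_zero_iff {α β z : ℂ} {h : ℝ} (hz : 2 * ‖z‖ ≤ h) :
    majorSq α β z h = 0 ↔ α = β ∧ h = 0 := by
  have h0 := norm_nonneg z
  constructor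
  · intro h1
    have h2 := sq_nonneg ‖α - β‖
    have h3 := norm_nonneg (discr α β z)
    rw [majorSq] at h1
    have h4 : ‖α - β‖ ^ 2 = 0 := by linarith
    exact ⟨by simpa [sub_eq_zero] using h4, by linarith⟩
  · rintro ⟨rfl, rfl⟩
    have hz0 : z = 0 := by
      rw [← norm_eq_zero]
      linarith
    simp [majorSq, discr, hz0]

lemma isEllipse_ellipseOf {α β z : ℂ} {h : ℝ} (hz : 2 * ‖z‖ ≤ h) :
    IsEllipse (ellipseOf α β z h) (focusPlus α β z) (focusMinus α β z)
      (√(majorSq α β z h)) (√(minorSq α β z h)) := by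
  have hM := majorSq_nonneg (α := α) (β := β) hz
  have hm := minorSq_nonneg (α := α) (β := β) hz
  have hmeq := minorSq_eq α β z h
  refine ⟨Real.sqrt_nonneg _, Real.sqrt_nonneg _, ?_, fun hb => ?_, fun hb => ?_⟩
  · have h1 : dist (focusPlus α β z) (focusMinus α β z) = 2 * ‖halfFocal α β z‖ := by
      rw [dist_eq_norm, focusPlus, focusMinus, add_sub_sub_cancel, ← two_mul, norm_mul,
        ← halfFocal]
      simp
    rw [Real.sq_sqrt hM, Real.sq_sqrt hm, h1, majorSq_eq, minorSq_eq]
    ring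
  · rw [Real.sqrt_pos] at hb
    rw [ellipseOf, ellipse, if_pos (by linarith), majorSq_eq]
    rfl
  · rw [Real.sqrt_eq_zero hm] at hb
    rw [ellipseOf, ellipse, if_neg (by linarith)]
    rfl

/-- The Hermitian matrix `[[a, x], [\bar x, b]]` with `a = Re (ω (α - μ))`, `b = Re (ω (β - μ))` and
`|x|² = (h |ω|² + 2 Re (ω² z)) / 4` is negative definite. This is the block of `Re (ω (A - μ))`
that belongs to the joint eigenvalues `z`, `h`. -/
def IsNegDirection (α β z : ℂ) (h : ℝ) (μ ω : ℂ) : Prop :=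
  (ω * (α - μ)).re < 0 ∧
    (h * ‖ω‖ ^ 2 + 2 * (ω ^ 2 * z).re) / 4 < (ω * (α - μ)).re * (ω * (β - μ)).re

lemma nonneg_of_two_mul_norm_le {z : ℂ} {h : ℝ} (hz : 2 * ‖z‖ ≤ h) (ω : ℂ) :
    0 ≤ h * ‖ω‖ ^ 2 + 2 * (ω ^ 2 * z).re := by
  have h1 := abs_le.mp (Complex.abs_re_le_norm (ω ^ 2 * z))
  rw [norm_mul, norm_pow] at h1
  have h2 := mul_le_mul_of_nonneg_right hz (sq_nonneg ‖ω‖)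
  linarith [h1.1]

/-- The ellipse lies in the open half-plane `Re (ω (w - μ)) < 0` if and only if `ω` is a negative
direction: both sides say that the larger eigenvalue of the `2 × 2` matrix is negative. -/
lemma isNegDirection_iff {α β z μ ω : ℂ} {h : ℝ} (hz : 2 * ‖z‖ ≤ h) :
    IsNegDirection α β z h μ ω ↔
      (ω * ((α + β) / 2 - μ)).re +
        √(supportSq (halfFocal α β z) (‖α - β‖ ^ 2 / 2 + h) ω) / 2 < 0 := by
  have hg := nonneg_of_two_mul_norm_le hz ω
  have hc : (ω * ((α + β) / 2 - μ)).re = ((ω * (α - μ)).re + (ω * (β - μ)).re) / 2 := by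
    rw [← Complex.add_re, ← Complex.div_ofNat_re]
    congr 1
    ring
  have hs : supportSq (halfFocal α β z) (‖α - β‖ ^ 2 / 2 + h) ω =
      ((ω * (α - μ)).re - (ω * (β - μ)).re) ^ 2 + (h * ‖ω‖ ^ 2 + 2 * (ω ^ 2 * z).re) := by
    have h1 : (ω * (α - μ)).re - (ω * (β - μ)).re = (ω * (α - β)).re := by
      rw [← Complex.sub_re]
      congr 1
      ring
    have h2 : ω ^ 2 * (discr α β z / 4) = (ω * (α - β)) ^ 2 / 4 + ω ^ 2 * z := by
      rw [discr]
      ring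
    rw [supportSq, halfFocal_sq, h1, h2, Complex.add_re, Complex.div_ofNat_re]
    have h3 : ‖α - β‖ ^ 2 * ‖ω‖ ^ 2 = ‖ω * (α - β)‖ ^ 2 := by
      rw [norm_mul]
      ring
    have h4 : ((ω * (α - β)) ^ 2).re = 2 * (ω * (α - β)).re ^ 2 - ‖ω * (α - β)‖ ^ 2 := by
      rw [Complex.sq_norm, Complex.normSq_apply, pow_two, Complex.mul_re]
      ring
    rw [h4]
    linear_combination h3 / 2
  rw [IsNegDirection, hc, hs]
  generalize (ω * (α - μ)).re = a at *
  generalize (ω * (β - μ)).re = b at *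
  generalize h * ‖ω‖ ^ 2 + 2 * (ω ^ 2 * z).re = g at *
  rw [show (a + b) / 2 + √((a - b) ^ 2 + g) / 2 < 0 ↔ √((a - b) ^ 2 + g) < -(a + b) by
    constructor <;> intro h <;> linarith]
  constructor
  · rintro ⟨ha, hab⟩
    have hb : b < 0 := by
      by_contra! hb
      nlinarith
    rw [Real.sqrt_lt' (by linarith)]
    nlinarith
  · intro hlt
    have h0 : 0 < -(a + b) := (Real.sqrt_nonneg _).trans_lt hlt
    rw [Real.sqrt_lt' h0] at hlt
    have hab : g / 4 < a * b := by nlinarith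
    refine ⟨?_, hab⟩
    by_contra! ha
    nlinarith

/-- Membership in the convex hull of a union of the ellipses, by means of half-planes. -/
lemma mem_convexHull_biUnion_ellipseOf_iff {S : Type*} {α β μ : ℂ} {z : S → ℂ} {h : S → ℝ}
    (hz : ∀ j, 2 * ‖z j‖ ≤ h j) (J : Finset S) :
    μ ∈ convexHull ℝ (⋃ j ∈ J, ellipseOf α β (z j) (h j)) ↔
      ∀ ω : ℂ, ∃ j ∈ J, ¬ IsNegDirection α β (z j) (h j) μ ω := by
  have hk : ∀ j, 2 * ‖halfFocal α β (z j)‖ ^ 2 ≤ ‖α - β‖ ^ 2 / 2 + h j := fun j => by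
    have := minorSq_nonneg (α := α) (β := β) (hz j)
    rw [minorSq_eq] at this
    linarith
  have hsplit : ∀ ω w : ℂ, (ω * (w - μ)).re =
      (ω * ((α + β) / 2 - μ)).re + (ω * (w - (α + β) / 2)).re := fun ω w => by
    rw [← Complex.add_re]
    congr 1
    ring
  constructor
  · intro hμ ω
    by_contra! hcon
    let H : Set ℂ := {w | (ω * (w - μ)).re < 0}
    have hH : Convex ℝ H := by
      have : H = (fun w => (ω * w).re) ⁻¹' Set.Iio (ω * μ).re := by
        ext w
        simp [H, mul_sub, sub_neg]
      rw [this]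
      refine (convex_Iio _).is_linear_preimage ⟨fun x y => ?_, fun c x => ?_⟩
      · rw [mul_add, Complex.add_re]
      · rw [mul_smul_comm, Complex.smul_re]
    have hsub : (⋃ j ∈ J, ellipseOf α β (z j) (h j)) ⊆ H := by
      intro w hw
      simp only [Set.mem_iUnion] at hw
      obtain ⟨j, hj, hw⟩ := hw
      have h1 := (isNegDirection_iff (hz j)).mp (hcon j hj)
      have h2 := re_mul_sub_le_of_mem_ellipse (hk j) hw ω
      change (ω * (w - μ)).re < 0
      rw [hsplit]
      linarith
    have := convexHull_min hsub hH hμ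
    simp [H] at this
  · intro hω
    by_contra hμ
    have hcomp : IsCompact (convexHull ℝ (⋃ j ∈ J, ellipseOf α β (z j) (h j))) :=
      isCompact_convexHull (J.isCompact_biUnion fun j _ => isCompact_ellipse _ _ _)
    obtain ⟨f, u, hf, hu⟩ := geometric_hahn_banach_closed_point (convex_convexHull ℝ _)
      hcomp.isClosed hμ
    -- the separating functional is `w ↦ Re (ω w)`
    have hfω : ∀ w : ℂ, f w = ((⟨f 1, -f Complex.I⟩ : ℂ) * w).re := by
      intro w
      have : w = w.re • (1 : ℂ) + w.im • Complex.I := by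
        apply Complex.ext <;> simp
      conv_lhs => rw [this]
      rw [map_add, map_smul, map_smul, Complex.mul_re]
      simp only [smul_eq_mul]
      ring
    obtain ⟨j, hj, hneg⟩ := hω ⟨f 1, -f Complex.I⟩
    apply hneg
    obtain ⟨w, hw, hwω⟩ := exists_mem_ellipse_re_mul_sub_eq (c := (α + β) / 2) (hk j)
      ⟨f 1, -f Complex.I⟩
    rw [isNegDirection_iff (hz j), ← hwω, ← hsplit, mul_sub, Complex.sub_re, ← hfω, ← hfω]
    have := hf w (subset_convexHull ℝ _ (Set.mem_biUnion hj hw))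
    linarith

end TwoByTwo

/-! ### Compressions of the block matrix -/

section Extension

variable {R S : Type*} [DecidableEq S]

/-- Extension by zero from `R ⊕ J` to `R ⊕ S`. -/
noncomputable def extendBlock (J : Finset S) : (R ⊕ J → ℂ) →ₗ[ℂ] (R ⊕ S → ℂ) :=
  LinearMap.pi (Sum.elim (fun i => LinearMap.proj (Sum.inl i))
    fun j => if hj : j ∈ J then LinearMap.proj (Sum.inr ⟨j, hj⟩) else 0)

lemma extendBlock_inr_of_mem {J : Finset S} (y : R ⊕ J → ℂ) (j : J) :
    extendBlock J y (Sum.inr j) = y (Sum.inr j) := by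
  simp [extendBlock]

lemma extendBlock_inr_of_notMem {J : Finset S} (y : R ⊕ J → ℂ) {j : S} (hj : j ∉ J) :
    extendBlock J y (Sum.inr j) = 0 := by
  simp [extendBlock, hj]

lemma extendBlock_injective (J : Finset S) :
    Function.Injective (extendBlock (R := R) J) := by
  intro x y hxy
  ext (i | j)
  · exact congrFun hxy (Sum.inl i)
  · have := congrFun hxy (Sum.inr j)
    rwa [extendBlock_inr_of_mem, extendBlock_inr_of_mem] at this

lemma eq_zero_of_mem_range_extendBlock {J : Finset S} {x : R ⊕ S → ℂ}
    (hx : x ∈ LinearMap.range (extendBlock (R := R) J)) {j : S} (hj : j ∉ J) :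
    x (Sum.inr j) = 0 := by
  obtain ⟨y, rfl⟩ := hx
  exact extendBlock_inr_of_notMem y hj

lemma finrank_range_extendBlock [Fintype R] (J : Finset S) :
    Module.finrank ℂ (LinearMap.range (extendBlock (R := R) J)) = Fintype.card R + J.card := by
  rw [LinearMap.finrank_range_of_inj (extendBlock_injective J)]
  simp

end Extension

section Block

lemma fromBlocks_sub_smul_one {R S : Type*} [DecidableEq R] [DecidableEq S]
    (α β μ : ℂ) (C : Matrix R S ℂ) (D : Matrix S R ℂ) :
    Matrix.fromBlocks (α • 1) C D (β • 1) - μ • (1 : Matrix (R ⊕ S) (R ⊕ S) ℂ) =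
      Matrix.fromBlocks ((α - μ) • 1) C D ((β - μ) • 1) := by
  rw [← Matrix.fromBlocks_one, Matrix.fromBlocks_smul, sub_eq_add_neg, Matrix.fromBlocks_neg,
    Matrix.fromBlocks_add]
  simp [add_smul, sub_eq_add_neg]

variable {R S : Type*} [DecidableEq S]

/-- The off-diagonal block of `2 Re (ω A)` has a diagonal Gram matrix. -/
lemma conjTranspose_mul_self_eq_diagonal [Fintype R] {C : Matrix R S ℂ}
    {D : Matrix S R ℂ} {z : S → ℂ} {h : S → ℝ} (hz : D * C = Matrix.diagonal z)
    (hh : Cᴴ * C + D * Dᴴ = Matrix.diagonal fun j => (h j : ℂ)) (ω : ℂ) :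
    (ω • C + star ω • Dᴴ)ᴴ * (ω • C + star ω • Dᴴ) =
      Matrix.diagonal fun j => ((h j * ‖ω‖ ^ 2 + 2 * (ω ^ 2 * z j).re : ℝ) : ℂ) := by
  have hz' : Cᴴ * Dᴴ = Matrix.diagonal (star z) := by
    rw [← Matrix.conjTranspose_mul, hz, Matrix.diagonal_conjTranspose]
  have h1 : (ω • C + star ω • Dᴴ)ᴴ * (ω • C + star ω • Dᴴ) =
      (star ω * ω) • (Cᴴ * C + D * Dᴴ) + (ω ^ 2) • (D * C) + (star ω ^ 2) • (Cᴴ * Dᴴ) := by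
    simp only [Matrix.conjTranspose_add, Matrix.conjTranspose_smul, star_star,
      Matrix.conjTranspose_conjTranspose, Matrix.add_mul, Matrix.mul_add, Matrix.smul_mul,
      Matrix.mul_smul, smul_smul, smul_add]
    rw [mul_comm ω (star ω), pow_two, pow_two]
    abel
  rw [h1, hh, hz, hz', ← Matrix.diagonal_smul, ← Matrix.diagonal_smul, ← Matrix.diagonal_smul,
    Matrix.diagonal_add, Matrix.diagonal_add]
  congr 1
  ext j
  simp only [Pi.smul_apply, smul_eq_mul, Pi.star_apply]
  have h2 : star ω * ω = ((‖ω‖ ^ 2 : ℝ) : ℂ) := by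
    rw [Complex.star_def, Complex.conj_mul', Complex.ofReal_pow]
  have h3 : ω ^ 2 * z j + star ω ^ 2 * star (z j) = ((2 * (ω ^ 2 * z j).re : ℝ) : ℂ) := by
    rw [← star_pow, ← star_mul', Complex.star_def, Complex.add_conj]
  rw [h2, add_assoc, h3]
  push_cast
  ring

end Block

section Block

variable {R S : Type*} [Fintype R] [Fintype S]

lemma star_dotProduct_self (v : S → ℂ) : star v ⬝ᵥ v = ((∑ j, ‖v j‖ ^ 2 : ℝ) : ℂ) := by
  simp [dotProduct, Complex.conj_mul']

lemma star_dotProduct_fromBlocks_mulVec [DecidableEq R] [DecidableEq S] (a b : ℂ)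
    (C : Matrix R S ℂ) (D : Matrix S R ℂ) (u : R → ℂ) (v : S → ℂ) :
    star (Sum.elim u v) ⬝ᵥ (Matrix.fromBlocks (a • 1) C D (b • 1) *ᵥ Sum.elim u v) =
      a * (star u ⬝ᵥ u) + star u ⬝ᵥ (C *ᵥ v) + star v ⬝ᵥ (D *ᵥ u) + b * (star v ⬝ᵥ v) := by
  rw [Matrix.fromBlocks_mulVec, Sum.elim_comp_inl, Sum.elim_comp_inr, Matrix.smul_mulVec,
    Matrix.smul_mulVec, Matrix.one_mulVec, Matrix.one_mulVec]
  have h : star (Sum.elim u v) = Sum.elim (star u) (star v) := by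
    ext (i | i) <;> rfl
  rw [h, sumElim_dotProduct_sumElim, dotProduct_add, dotProduct_add, dotProduct_smul,
    dotProduct_smul, smul_eq_mul, smul_eq_mul]
  ring

lemma re_mul_star_dotProduct_mulVec (ω : ℂ) (C : Matrix R S ℂ) (D : Matrix S R ℂ) (u : R → ℂ)
    (v : S → ℂ) :
    (ω * (star u ⬝ᵥ (C *ᵥ v) + star v ⬝ᵥ (D *ᵥ u))).re =
      (star u ⬝ᵥ ((ω • C + star ω • Dᴴ) *ᵥ v)).re := by
  have h : star (star v ⬝ᵥ (D *ᵥ u)) = star u ⬝ᵥ (Dᴴ *ᵥ v) := by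
    rw [← Matrix.star_dotProduct_star, star_star, Matrix.star_mulVec, ← Matrix.dotProduct_mulVec]
  rw [Matrix.add_mulVec, Matrix.smul_mulVec, Matrix.smul_mulVec, dotProduct_add, dotProduct_smul,
    dotProduct_smul, ← h, mul_add, Complex.add_re, Complex.add_re, smul_eq_mul, smul_eq_mul,
    ← star_mul', Complex.star_def, Complex.conj_re]

variable [DecidableEq S]

lemma sum_norm_sq_mulVec {M : Matrix R S ℂ} {g : S → ℝ}
    (hM : Mᴴ * M = Matrix.diagonal fun j => (g j : ℂ)) (v : S → ℂ) :
    ∑ i, ‖(M *ᵥ v) i‖ ^ 2 = ∑ j, g j * ‖v j‖ ^ 2 := by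
  have h1 := star_dotProduct_self (M *ᵥ v)
  rw [Matrix.star_mulVec, ← Matrix.dotProduct_mulVec, Matrix.mulVec_mulVec, hM] at h1
  rw [← Complex.ofReal_inj, ← h1]
  push_cast
  refine Finset.sum_congr rfl fun j _ => ?_
  rw [Matrix.mulVec_diagonal, Pi.star_apply, mul_left_comm, Complex.star_def, Complex.conj_mul']

/-- The diagonal entries `h_j |ω|² + 2 Re (ω² z_j)` of a Gram matrix are non-negative for
all `ω`. -/
lemma two_mul_norm_le {C : Matrix R S ℂ} {D : Matrix S R ℂ} {z : S → ℂ}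
    {h : S → ℝ} (hz : D * C = Matrix.diagonal z)
    (hh : Cᴴ * C + D * Dᴴ = Matrix.diagonal fun j => (h j : ℂ)) (j : S) : 2 * ‖z j‖ ≤ h j := by
  have key : ∀ ω : ℂ, 0 ≤ h j * ‖ω‖ ^ 2 + 2 * (ω ^ 2 * z j).re := fun ω => by
    have := sum_norm_sq_mulVec (conjTranspose_mul_self_eq_diagonal hz hh ω) (Pi.single j 1)
    rw [Finset.sum_eq_single j (fun i _ hi => by simp [hi]) (by simp)] at this
    rw [Pi.single_eq_same, norm_one, one_pow, mul_one] at this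
    rw [← this]
    positivity
  by_cases h0 : z j = 0
  · simpa [h0] using key 1
  · obtain ⟨ω, hω⟩ := IsAlgClosed.exists_pow_nat_eq (-star (z j)) (n := 2) two_pos
    have h1 := key ω
    have h2 : ‖ω‖ ^ 2 = ‖z j‖ := by rw [← norm_pow, hω, norm_neg, norm_star]
    have h3 : (ω ^ 2 * z j).re = -‖z j‖ ^ 2 := by
      rw [hω, neg_mul, Complex.star_def, Complex.conj_mul', Complex.neg_re, ← Complex.ofReal_pow,
        Complex.ofReal_re]
    rw [h2, h3] at h1
    have h4 : 0 < ‖z j‖ := norm_pos_iff.mpr h0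
    by_contra! hcon
    nlinarith

variable [DecidableEq R]

/-- If `ω` is a negative direction for all indices in `J`, then `Re (ω (A - μ))` is negative
definite on the coordinate subspace of `R ⊕ J`, and an isotropic subspace of `A - μ` meets it only
in `0`. The hypothesis `hα` says something only for empty `J`. -/
lemma add_card_le_of_isNegDirection {C : Matrix R S ℂ} {D : Matrix S R ℂ} {z : S → ℂ}
    {h : S → ℝ} (hz : D * C = Matrix.diagonal z)
    (hh : Cᴴ * C + D * Dᴴ = Matrix.diagonal fun j => (h j : ℂ)) {α β μ ω : ℂ} {k : ℕ}
    (hk : HasIsotropicSubspace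
      (Matrix.fromBlocks (α • 1) C D (β • 1) - μ • (1 : Matrix (R ⊕ S) (R ⊕ S) ℂ)) k)
    (J : Finset S) (hα : (ω * (α - μ)).re < 0)
    (hJ : ∀ j ∈ J, IsNegDirection α β (z j) (h j) μ ω) : k + J.card ≤ Fintype.card S := by
  rw [fromBlocks_sub_smul_one] at hk
  suffices H : ∀ x ∈ LinearMap.range (extendBlock (R := R) J), star x ⬝ᵥ
      (Matrix.fromBlocks ((α - μ) • 1) C D ((β - μ) • 1) *ᵥ x) = 0 → x = 0 by
    have := hk.add_finrank_le H
    rw [finrank_range_extendBlock, Fintype.card_sum] at this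
    omega
  intro x hx hx0
  have hxJ := fun j => eq_zero_of_mem_range_extendBlock hx (j := j)
  obtain ⟨u, v, rfl⟩ : ∃ u v, x = Sum.elim u v := ⟨_, _, (Sum.elim_comp_inl_inr x).symm⟩
  simp only [Sum.elim_inr] at hxJ
  rw [star_dotProduct_fromBlocks_mulVec] at hx0
  have h1 := congrArg (fun w => (ω * w).re) hx0
  simp only [mul_zero, Complex.zero_re] at h1
  have hM := sum_norm_sq_mulVec (conjTranspose_mul_self_eq_diagonal hz hh ω) v
  have hre := re_mul_star_dotProduct_mulVec ω C D u v
  set m := (ω • C + star ω • Dᴴ) *ᵥ v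
  set a := (ω * (α - μ)).re
  set b := (ω * (β - μ)).re
  have h2 : a * (∑ i, ‖u i‖ ^ 2) + (star u ⬝ᵥ m).re + b * (∑ j, ‖v j‖ ^ 2) = 0 := by
    rw [← h1, ← hre]
    rw [show ω * ((α - μ) * (star u ⬝ᵥ u) + star u ⬝ᵥ C *ᵥ v + star v ⬝ᵥ D *ᵥ u +
      (β - μ) * (star v ⬝ᵥ v)) = ω * (α - μ) * (star u ⬝ᵥ u) +
        ω * (star u ⬝ᵥ C *ᵥ v + star v ⬝ᵥ D *ᵥ u) + ω * (β - μ) * (star v ⬝ᵥ v) by ring,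
      Complex.add_re, Complex.add_re, star_dotProduct_self, star_dotProduct_self,
      Complex.re_mul_ofReal, Complex.re_mul_ofReal]
  -- completion of the square
  have h3 : ∑ i, ‖2 * a * u i + m i‖ ^ 2 =
      4 * a ^ 2 * (∑ i, ‖u i‖ ^ 2) + 4 * a * (star u ⬝ᵥ m).re + ∑ i, ‖m i‖ ^ 2 := by
    rw [dotProduct, Complex.re_sum, Finset.mul_sum, Finset.mul_sum, ← Finset.sum_add_distrib,
      ← Finset.sum_add_distrib]
    refine Finset.sum_congr rfl fun i _ => ?_
    simp only [Complex.sq_norm, Complex.normSq_apply]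
    simp
    ring
  have h4 : ∑ i, ‖2 * a * u i + m i‖ ^ 2 + ∑ j, (4 * (a * b) -
      (h j * ‖ω‖ ^ 2 + 2 * (ω ^ 2 * z j).re)) * ‖v j‖ ^ 2 = 0 := by
    simp only [sub_mul, Finset.sum_sub_distrib, ← Finset.mul_sum]
    rw [h3, hM]
    linear_combination 4 * a * h2
  have h5 : ∀ j ∈ Finset.univ, 0 ≤ (4 * (a * b) -
      (h j * ‖ω‖ ^ 2 + 2 * (ω ^ 2 * z j).re)) * ‖v j‖ ^ 2 := fun j _ => by
    by_cases hj : j ∈ J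
    · have := (hJ j hj).2
      exact mul_nonneg (by linarith) (by positivity)
    · simp [hxJ j hj]
  have h6 : ∀ i ∈ Finset.univ, 0 ≤ ‖2 * a * u i + m i‖ ^ 2 := fun i _ => by positivity
  obtain ⟨h7, h8⟩ := (add_eq_zero_iff_of_nonneg (Finset.sum_nonneg h6)
    (Finset.sum_nonneg h5)).mp h4
  have hv : v = 0 := by
    ext j
    by_cases hj : j ∈ J
    · have h9 := (Finset.sum_eq_zero_iff_of_nonneg h5).mp h8 j (Finset.mem_univ j)
      have h10 := (hJ j hj).2
      rcases mul_eq_zero.mp h9 with h9 | h9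
      · linarith
      · simpa using h9
    · exact hxJ j hj
  have hm : m = 0 := by simp [m, hv]
  have hu : u = 0 := by
    ext i
    have h9 := (Finset.sum_eq_zero_iff_of_nonneg h6).mp h7 i (Finset.mem_univ i)
    simpa [hm, hα.ne] using h9
  rw [hu, hv]
  ext (i | i) <;> rfl

/-- The kernel of `H` together with `ℂ^R` is isotropic for `A - α` if `α = β`; in general `ℂ^R`
is. -/
lemma hasIsotropicSubspace_sub_alpha {C : Matrix R S ℂ} {D : Matrix S R ℂ} {h : S → ℝ}
    (hh : Cᴴ * C + D * Dᴴ = Matrix.diagonal fun j => (h j : ℂ)) {α β : ℂ} (J : Finset S)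
    (hJ : ∀ j ∈ J, α = β ∧ h j = 0) :
    HasIsotropicSubspace
      (Matrix.fromBlocks (α • 1) C D (β • 1) - α • (1 : Matrix (R ⊕ S) (R ⊕ S) ℂ))
      (Fintype.card R + J.card) := by
  refine ⟨LinearMap.range (extendBlock J), (finrank_range_extendBlock J).ge, fun x hx => ?_⟩
  have hxJ := fun j => eq_zero_of_mem_range_extendBlock hx (j := j)
  obtain ⟨u, v, rfl⟩ : ∃ u v, x = Sum.elim u v := ⟨_, _, (Sum.elim_comp_inl_inr x).symm⟩
  simp only [Sum.elim_inr] at hxJ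
  rw [fromBlocks_sub_smul_one, star_dotProduct_fromBlocks_mulVec, sub_self, zero_mul, zero_add]
  have hsum : ∑ i, ‖(C *ᵥ v) i‖ ^ 2 + ∑ i, ‖(Dᴴ *ᵥ v) i‖ ^ 2 = 0 := by
    have h1 : star (C *ᵥ v) ⬝ᵥ (C *ᵥ v) + star (Dᴴ *ᵥ v) ⬝ᵥ (Dᴴ *ᵥ v) = 0 := by
      rw [Matrix.star_mulVec, ← Matrix.dotProduct_mulVec, Matrix.mulVec_mulVec,
        Matrix.star_mulVec, ← Matrix.dotProduct_mulVec, Matrix.mulVec_mulVec, ← dotProduct_add,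
        ← Matrix.add_mulVec, Matrix.conjTranspose_conjTranspose, hh]
      refine Finset.sum_eq_zero fun j _ => ?_
      rw [Matrix.mulVec_diagonal]
      by_cases hj : j ∈ J
      · simp [(hJ j hj).2]
      · simp [hxJ j hj]
    rw [star_dotProduct_self, star_dotProduct_self] at h1
    exact_mod_cast h1
  obtain ⟨h1, h2⟩ := (add_eq_zero_iff_of_nonneg (Finset.sum_nonneg fun i _ => by positivity)
    (Finset.sum_nonneg fun i _ => by positivity)).mp hsum
  have hC : C *ᵥ v = 0 := by
    ext i
    simpa using (Finset.sum_eq_zero_iff_of_nonneg fun i _ => by positivity).mp h1 i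
      (Finset.mem_univ i)
  have hD : Dᴴ *ᵥ v = 0 := by
    ext i
    simpa using (Finset.sum_eq_zero_iff_of_nonneg fun i _ => by positivity).mp h2 i
      (Finset.mem_univ i)
  have hD' : star v ⬝ᵥ (D *ᵥ u) = 0 := by
    rw [Matrix.dotProduct_mulVec, ← star_star (star v ᵥ* D), Matrix.star_vecMul, star_star, hD]
    simp
  have hb : (β - α) * (star v ⬝ᵥ v) = 0 := by
    by_cases hab : α = β
    · simp [hab]
    · have : v = 0 := by
        ext j
        exact hxJ j fun hj => hab (hJ j hj).1
      simp [this]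
  rw [hC, hD', hb]
  simp

/-- For `α = β` and a suitable `ω` the form of `Re (ω (A - α))` is positive definite on a subspace
whose dimension is the rank of `H`, namely on the vectors `(M v, v)` with `M = ω C + \bar ω D^*` and
with `v` supported where `h` does not vanish. -/
lemma add_card_le_of_eq {C : Matrix R S ℂ} {D : Matrix S R ℂ} {z : S → ℂ}
    {h : S → ℝ} (hz : D * C = Matrix.diagonal z)
    (hh : Cᴴ * C + D * Dᴴ = Matrix.diagonal fun j => (h j : ℂ)) {α : ℂ} {k : ℕ}
    (hk : HasIsotropicSubspace
      (Matrix.fromBlocks (α • 1) C D (α • 1) - α • (1 : Matrix (R ⊕ S) (R ⊕ S) ℂ)) k) :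
    k + (Finset.univ.filter fun j => h j ≠ 0).card ≤ Fintype.card R + Fintype.card S := by
  rw [fromBlocks_sub_smul_one, sub_self] at hk
  have hzh := two_mul_norm_le hz hh
  have hh0 : ∀ j, 0 ≤ h j := fun j => by
    have := hzh j
    have := norm_nonneg (z j)
    linarith
  -- for each `j` with `h j ≠ 0`, a nonzero polynomial in `t` has to be avoided
  obtain ⟨t, ht⟩ : ∃ t : ℝ, ∀ j, h j ≠ 0 →
      h j * ‖(1 + t * Complex.I : ℂ)‖ ^ 2 + 2 * ((1 + t * Complex.I : ℂ) ^ 2 * z j).re ≠ 0 := by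
    let P : S → Polynomial ℝ := fun j =>
      Polynomial.C (h j - 2 * (z j).re) * Polynomial.X ^ 2 +
        Polynomial.C (-4 * (z j).im) * Polynomial.X + Polynomial.C (h j + 2 * (z j).re)
    have hP : ∀ j (t : ℝ), (P j).eval t =
        h j * ‖(1 + t * Complex.I : ℂ)‖ ^ 2 + 2 * ((1 + t * Complex.I : ℂ) ^ 2 * z j).re := by
      intro j t
      rw [Complex.sq_norm, Complex.normSq_apply]
      simp [P, pow_two]
      ring
    have hP0 : ∀ j, h j ≠ 0 → P j ≠ 0 := by
      intro j hj hP0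
      have h1 : (P j).eval 0 = 0 := by rw [hP0, Polynomial.eval_zero]
      have h2 : (P j).eval 1 = 0 := by rw [hP0, Polynomial.eval_zero]
      have h3 : (P j).eval (-1) = 0 := by rw [hP0, Polynomial.eval_zero]
      simp [P] at h1 h2 h3
      exact hj (by linarith)
    have hfin : (⋃ j ∈ {j | h j ≠ 0}, {t | (P j).IsRoot t}).Finite :=
      Set.Finite.biUnion (Set.toFinite _) fun j hj => Polynomial.finite_setOfPred_isRoot (hP0 j hj)
    obtain ⟨t, ht⟩ := hfin.infinite_compl.nonempty
    refine ⟨t, fun j hj h0 => ht ?_⟩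
    exact Set.mem_biUnion hj (by rw [Set.mem_ofPred_eq, Polynomial.IsRoot, hP, h0])
  set ω : ℂ := 1 + t * Complex.I
  set J := Finset.univ.filter fun j => h j ≠ 0
  set M : Matrix R S ℂ := ω • C + star ω • Dᴴ
  have hM := sum_norm_sq_mulVec (conjTranspose_mul_self_eq_diagonal hz hh ω)
  let Φ : (J → ℂ) →ₗ[ℂ] (R ⊕ S → ℂ) := LinearMap.pi (Sum.elim
    (fun i => LinearMap.proj i ∘ₗ M.mulVecLin) fun j => LinearMap.proj j) ∘ₗ
      Function.ExtendByZero.linearMap ℂ (Subtype.val : J → S)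
  have hΦ : ∀ y, Φ y = Sum.elim (M *ᵥ Function.extend Subtype.val y 0)
      (Function.extend Subtype.val y 0) := fun y => by
    ext (i | i) <;> rfl
  have hinj : Function.Injective Φ := fun x y hxy => by
    ext j
    have := congrFun hxy (Sum.inr j)
    rwa [hΦ, hΦ, Sum.elim_inr, Sum.elim_inr, Subtype.val_injective.extend_apply,
      Subtype.val_injective.extend_apply] at this
  suffices H : ∀ x ∈ LinearMap.range Φ, star x ⬝ᵥ
      (Matrix.fromBlocks ((0 : ℂ) • 1) C D ((0 : ℂ) • 1) *ᵥ x) = 0 → x = 0 by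
    have := hk.add_finrank_le H
    rw [LinearMap.finrank_range_of_inj hinj, Fintype.card_sum] at this
    simpa using this
  rintro _ ⟨y, rfl⟩ hx0
  have hy : ∀ j ∉ J, Function.extend Subtype.val y 0 j = 0 := fun j hj =>
    Function.extend_apply' _ _ _ (by simpa using hj)
  rw [hΦ] at hx0 ⊢
  generalize (Function.extend Subtype.val y 0 : S → ℂ) = v at *
  rw [star_dotProduct_fromBlocks_mulVec, zero_mul, zero_mul, zero_add, add_zero] at hx0
  have h1 := re_mul_star_dotProduct_mulVec ω C D (M *ᵥ v) v
  rw [hx0, mul_zero, Complex.zero_re, star_dotProduct_self, Complex.ofReal_re, hM] at h1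
  have h2 : ∀ j ∈ Finset.univ,
      0 ≤ (h j * ‖ω‖ ^ 2 + 2 * (ω ^ 2 * z j).re) * ‖v j‖ ^ 2 := fun j _ =>
    mul_nonneg (nonneg_of_two_mul_norm_le (hzh j) ω) (by positivity)
  have hv : v = 0 := by
    ext j
    by_cases hj : j ∈ J
    · have h3 := (Finset.sum_eq_zero_iff_of_nonneg h2).mp h1.symm j (Finset.mem_univ j)
      rcases mul_eq_zero.mp h3 with h3 | h3
      · exact absurd h3 (ht j (Finset.mem_filter.mp hj).2)
      · simpa using h3
    · exact hy j hj
  rw [hv]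
  ext (i | i) <;> simp

/-- A matrix with orthogonal columns is an isometry times a diagonal matrix. As columns of the
isometry that belong to zero columns one can take any vectors that complete the orthonormal system;
they exist because of `#S ≤ #R`. -/
lemma exists_isometry_mul_diagonal {K : Matrix R S ℂ} {κ : S → ℝ}
    (hK : Kᴴ * K = Matrix.diagonal fun j => ((κ j ^ 2 : ℝ) : ℂ))
    (hcard : Fintype.card S ≤ Fintype.card R) :
    ∃ W : Matrix R S ℂ, Wᴴ * W = 1 ∧ K = W * Matrix.diagonal fun j => (κ j : ℂ) := by
  obtain ⟨e⟩ := Function.Embedding.nonempty_of_card_le hcard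
  let c : S → EuclideanSpace ℂ R := fun j => WithLp.toLp 2 fun i => K i j
  have hc : ∀ i j, inner ℂ (c i) (c j) = if i = j then ((κ j ^ 2 : ℝ) : ℂ) else 0 := fun i j => by
    have h1 := congrFun (congrFun hK i) j
    rw [Matrix.mul_apply, Matrix.diagonal_apply] at h1
    have h2 : (if i = j then ((κ j ^ 2 : ℝ) : ℂ) else 0) =
        if i = j then ((κ i ^ 2 : ℝ) : ℂ) else 0 := by
      split_ifs with hij
      · rw [hij]
      · rfl
    rw [h2, ← h1, EuclideanSpace.inner_eq_star_dotProduct]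
    simp [c, dotProduct, mul_comm]
  let v : R → EuclideanSpace ℂ R := Function.extend e (fun j => ((κ j : ℂ)⁻¹) • c j) 0
  have hv : ∀ j, v (e j) = ((κ j : ℂ)⁻¹) • c j := fun j => e.injective.extend_apply _ _ _
  let s : Set R := e '' {j | κ j ≠ 0}
  have hs : Orthonormal ℂ (s.domRestrict v) := by
    rw [orthonormal_iff_ite]
    rintro ⟨_, i, hi, rfl⟩ ⟨_, j, hj, rfl⟩
    have hi : (κ i : ℂ) ≠ 0 := by exact_mod_cast hi
    change inner ℂ (v (e i)) (v (e j)) = _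
    rw [hv, hv, inner_smul_left, inner_smul_right, hc]
    by_cases hij : i = j
    · subst hij
      rw [if_pos rfl, if_pos rfl, map_inv₀, Complex.conj_ofReal]
      push_cast
      field_simp
    · rw [if_neg hij, if_neg fun h => hij (e.injective (congrArg Subtype.val h)), mul_zero,
        mul_zero]
  obtain ⟨b, hb⟩ := hs.exists_orthonormalBasis_extension_of_card_eq (by simp)
  refine ⟨Matrix.of fun i j => b (e j) i, ?_, ?_⟩
  · ext i j
    have := orthonormal_iff_ite.mp b.orthonormal (e i) (e j)
    rw [EuclideanSpace.inner_eq_star_dotProduct] at this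
    simp only [e.injective.eq_iff] at this
    rw [Matrix.mul_apply, Matrix.one_apply, ← this]
    simp [dotProduct, mul_comm]
  · ext i j
    rw [Matrix.mul_diagonal, Matrix.of_apply]
    by_cases hj : κ j = 0
    · have h1 : c j = 0 := by
        rw [← inner_self_eq_zero (𝕜 := ℂ), hc, if_pos rfl, hj]
        simp
      have h2 : K i j = c j i := rfl
      rw [h2, h1, hj]
      simp
    · have hj' : (κ j : ℂ) ≠ 0 := by exact_mod_cast hj
      rw [hb (e j) ⟨j, hj, rfl⟩, hv]
      simp only [PiLp.smul_apply, smul_eq_mul, c]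
      field_simp

/-- With `L = C + D^*` and `C - D^* = W κ`, the restriction of the form of
`[[1, C], [D, b]]` to the vectors `(W x - L y / 2, y)` is a direct sum of forms in two variables. -/
lemma exists_injective_restrict_eq_pencilMatrix {C : Matrix R S ℂ} {D : Matrix S R ℂ} {z : S → ℂ}
    {h : S → ℝ} (hz : D * C = Matrix.diagonal z)
    (hh : Cᴴ * C + D * Dᴴ = Matrix.diagonal fun j => (h j : ℂ))
    (hcard : Fintype.card S ≤ Fintype.card R) (b : ℂ) :
    ∃ X : Matrix (R ⊕ S) (S ⊕ S) ℂ, Function.Injective X.mulVec ∧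
      Xᴴ * Matrix.fromBlocks 1 C D (b • 1) * X =
        pencilMatrix (fun j => -b.re + h j / 4 + (z j).re / 2) (fun j => b.im - (z j).im)
          (fun j => √(h j - 2 * (z j).re)) := by
  have hzh := two_mul_norm_le hz hh
  have hz' : Cᴴ * Dᴴ = Matrix.diagonal (star z) := by
    rw [← Matrix.conjTranspose_mul, hz, Matrix.diagonal_conjTranspose]
  have hpos : ∀ j, 0 ≤ h j - 2 * (z j).re := fun j => by
    have := hzh j
    have := Complex.re_le_norm (z j)
    linarith
  have hK : (C - Dᴴ)ᴴ * (C - Dᴴ) =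
      Matrix.diagonal fun j => ((√(h j - 2 * (z j).re) ^ 2 : ℝ) : ℂ) := by
    have h1 : (C - Dᴴ)ᴴ * (C - Dᴴ) = (Cᴴ * C + D * Dᴴ) - D * C - Cᴴ * Dᴴ := by
      simp only [Matrix.conjTranspose_sub, Matrix.conjTranspose_conjTranspose, Matrix.sub_mul,
        Matrix.mul_sub]
      abel
    rw [h1, hh, hz, hz', Matrix.diagonal_sub, Matrix.diagonal_sub]
    congr 1
    ext j
    rw [Real.sq_sqrt (hpos j), sub_sub, Pi.star_apply, Complex.star_def, Complex.add_conj]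
    push_cast
    ring
  obtain ⟨W, hW, hKW⟩ := exists_isometry_mul_diagonal hK hcard
  set κ : S → ℝ := fun j => √(h j - 2 * (z j).re)
  set L := C + Dᴴ
  refine ⟨Matrix.fromBlocks W (-(1 / 2 : ℂ) • L) 0 1, ?_, ?_⟩
  · intro x y hxy
    rw [Matrix.fromBlocks_mulVec, Matrix.fromBlocks_mulVec] at hxy
    have h2 : x ∘ Sum.inr = y ∘ Sum.inr := by
      ext j
      simpa using congrFun hxy (Sum.inr j)
    have h1 : x ∘ Sum.inl = y ∘ Sum.inl := by
      apply mulVec_injective_of_conjTranspose_mul_self hW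
      ext i
      have := congrFun hxy (Sum.inl i)
      rw [h2] at this
      simpa using this
    ext (i | i)
    · exact congrFun h1 i
    · exact congrFun h2 i
  · set E : Matrix S S ℂ := Matrix.diagonal fun j => (κ j : ℂ)
    have hE : Eᴴ = E := by
      rw [Matrix.diagonal_conjTranspose]
      congr 1
      ext j
      exact Complex.conj_ofReal _
    have hE2 : (Matrix.diagonal fun j => (κ j : ℂ) / 2) = (1 / 2 : ℂ) • E := by
      rw [← Matrix.diagonal_smul]
      congr 1
      ext j
      simp only [Pi.smul_apply, smul_eq_mul]
      ring
    have hX : (Matrix.fromBlocks W (-(1 / 2 : ℂ) • L) 0 (1 : Matrix S S ℂ))ᴴ =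
        Matrix.fromBlocks Wᴴ 0 (-(1 / 2 : ℂ) • Lᴴ) 1 := by
      rw [Matrix.fromBlocks_conjTranspose]
      simp
    have hC1 : -(1 / 2 : ℂ) • L + C = (1 / 2 : ℂ) • (C - Dᴴ) := by
      simp only [L]
      module
    have hD1 : -(1 / 2 : ℂ) • Lᴴ + D = -(1 / 2 : ℂ) • (C - Dᴴ)ᴴ := by
      simp only [L, Matrix.conjTranspose_add, Matrix.conjTranspose_sub,
        Matrix.conjTranspose_conjTranspose]
      module
    rw [hX, Matrix.mul_assoc, Matrix.fromBlocks_multiply, Matrix.fromBlocks_multiply, pencilMatrix,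
      hE2]
    congr 1
    · simp [hW]
    · simp only [Matrix.one_mul, Matrix.mul_one, Matrix.zero_mul, add_zero]
      rw [hC1, hKW, Matrix.mul_smul, ← Matrix.mul_assoc, hW, Matrix.one_mul]
    · simp only [Matrix.one_mul, Matrix.mul_zero, add_zero]
      rw [← Matrix.add_mul, hD1, hKW, Matrix.conjTranspose_mul, hE, Matrix.smul_mul,
        Matrix.mul_assoc, hW, Matrix.mul_one, neg_smul]
    · simp only [Matrix.one_mul, Matrix.mul_one]
      have h1 : -(1 / 2 : ℂ) • Lᴴ * (-(1 / 2 : ℂ) • L + C) + (D * (-(1 / 2 : ℂ) • L) + b • 1) =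
          b • 1 - (1 / 4 : ℂ) • (Cᴴ * C + D * Dᴴ) - (3 / 4 : ℂ) • (D * C) +
            (1 / 4 : ℂ) • (Cᴴ * Dᴴ) := by
        simp only [L, Matrix.conjTranspose_add, Matrix.conjTranspose_conjTranspose,
          Matrix.smul_mul, Matrix.mul_smul, Matrix.add_mul, Matrix.mul_add, smul_add]
        module
      rw [h1, hh, hz, hz', ← Matrix.diagonal_one, ← Matrix.diagonal_smul, ← Matrix.diagonal_smul,
        ← Matrix.diagonal_smul, ← Matrix.diagonal_smul, Matrix.diagonal_sub, Matrix.diagonal_sub,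
        Matrix.diagonal_add]
      congr 1
      ext j
      simp only [Pi.smul_apply, smul_eq_mul, Pi.star_apply]
      apply Complex.ext
      · simp
        ring
      · simp
        ring

/-- If every `ω` is a negative direction for at most `g` blocks, then `A - μ` has an isotropic
subspace of codimension `g` in the number of blocks. -/
lemma hasIsotropicSubspace_of_card_isNegDirection_le {C : Matrix R S ℂ} {D : Matrix S R ℂ}
    {z : S → ℂ} {h : S → ℝ} (hz : D * C = Matrix.diagonal z)
    (hh : Cᴴ * C + D * Dᴴ = Matrix.diagonal fun j => (h j : ℂ))
    (hcard : Fintype.card S ≤ Fintype.card R) {α β μ : ℂ} (hα : α ≠ μ) (g : ℕ)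
    (hg : ∀ (ω : ℂ) (J : Finset S), (∀ j ∈ J, IsNegDirection α β (z j) (h j) μ ω) → J.card ≤ g) :
    HasIsotropicSubspace
      (Matrix.fromBlocks (α • 1) C D (β • 1) - μ • (1 : Matrix (R ⊕ S) (R ⊕ S) ℂ))
      (Fintype.card S - g) := by
  rw [fromBlocks_sub_smul_one]
  set a := α - μ with ha
  have ha0 : a ≠ 0 := sub_ne_zero.mpr hα
  -- division by `a` makes the first diagonal block the identity
  have hscale : Matrix.fromBlocks (a • 1) C D ((β - μ) • 1) =
      a • Matrix.fromBlocks 1 (a⁻¹ • C) (a⁻¹ • D) (((β - μ) / a) • 1) := by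
    rw [Matrix.fromBlocks_smul, smul_smul, smul_smul, smul_smul, mul_inv_cancel₀ ha0, one_smul,
      one_smul, mul_div_cancel₀ _ ha0]
  have hz1 : (a⁻¹ • D) * (a⁻¹ • C) = Matrix.diagonal fun j => z j / a ^ 2 := by
    rw [Matrix.smul_mul, Matrix.mul_smul, hz, smul_smul, ← Matrix.diagonal_smul]
    congr 1
    ext j
    simp only [Pi.smul_apply, smul_eq_mul]
    field_simp
  have hh1 : (a⁻¹ • C)ᴴ * (a⁻¹ • C) + (a⁻¹ • D) * (a⁻¹ • D)ᴴ =
      Matrix.diagonal fun j => ((h j / ‖a‖ ^ 2 : ℝ) : ℂ) := by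
    rw [Matrix.conjTranspose_smul, Matrix.conjTranspose_smul, Matrix.smul_mul, Matrix.mul_smul,
      Matrix.smul_mul, Matrix.mul_smul, smul_smul, smul_smul, mul_comm (a⁻¹) (star a⁻¹),
      ← smul_add, hh, ← Matrix.diagonal_smul]
    congr 1
    ext j
    simp only [Pi.smul_apply, smul_eq_mul]
    rw [Complex.star_def, Complex.conj_mul', norm_inv]
    push_cast
    ring
  obtain ⟨X, hX, hXA⟩ := exists_injective_restrict_eq_pencilMatrix hz1 hh1 hcard ((β - μ) / a)
  rw [hscale]
  refine HasIsotropicSubspace.smul (HasIsotropicSubspace.of_restrict hX ?_) a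
  rw [hXA]
  refine hasIsotropicSubspace_pencilMatrix (fun j => Real.sqrt_nonneg _) g fun σ => ?_
  refine hg (-(1 + σ * Complex.I) / a) _ fun j hj => ?_
  have h1 := (Finset.mem_filter.mp hj).2
  have h2 := two_mul_norm_le hz1 hh1 j
  have h3 := Complex.re_le_norm (z j / a ^ 2)
  rw [Real.sq_sqrt (by linarith)] at h1
  have h4 : -(1 + σ * Complex.I) / a * a = -(1 + σ * Complex.I) := by field_simp
  have h5 : -(1 + σ * Complex.I) / a * (β - μ) = -(1 + σ * Complex.I) * ((β - μ) / a) := by ring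
  have h6 : (-(1 + σ * Complex.I) / a) ^ 2 * z j = (1 + σ * Complex.I) ^ 2 * (z j / a ^ 2) := by
    rw [div_pow, neg_sq, div_mul_eq_mul_div, mul_div_assoc]
  have h7 : h j * ‖-(1 + σ * Complex.I) / a‖ ^ 2 = h j / ‖a‖ ^ 2 * (1 + σ ^ 2) := by
    rw [norm_div, norm_neg, div_pow, Complex.sq_norm (1 + σ * Complex.I), Complex.normSq_apply]
    simp
    ring
  rw [IsNegDirection, ← ha, h4, h5, h6, h7]
  generalize z j / a ^ 2 = w at *
  generalize (β - μ) / a = b at *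
  generalize h j / ‖a‖ ^ 2 = t at *
  refine ⟨by simp, ?_⟩
  simp [pow_two] at h1 ⊢
  linarith

end Block

/-! ### The higher rank numerical ranges -/

section HigherRankRanges

variable {R S : Type*} [Fintype R] [Fintype S] [DecidableEq R] [DecidableEq S]
  {C : Matrix R S ℂ} {D : Matrix S R ℂ} {z : S → ℂ} {h : S → ℝ}

/-- More than `#S - k` negative directions in common are possible exactly if the hull for some set
of `#S - k + 1` indices does not contain `μ`. The point `μ = α` is in every hull and belongs to the
isotropic subspace `ℂ^R`. -/
lemma higherRankNumericalRange_fromBlocks_eq_iInter (hz : D * C = Matrix.diagonal z)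
    (hh : Cᴴ * C + D * Dᴴ = Matrix.diagonal fun j => (h j : ℂ))
    (hcard : Fintype.card S ≤ Fintype.card R) (α β : ℂ) {k : ℕ}
    (hkS : k ≤ Fintype.card S) :
    higherRankNumericalRange k (Matrix.fromBlocks (α • 1) C D (β • 1)) =
      ⋂ (J : Finset S) (_ : J.card = Fintype.card S - k + 1),
        convexHull ℝ (⋃ j ∈ J, ellipseOf α β (z j) (h j)) := by
  have hzh := two_mul_norm_le hz hh
  ext μ
  rw [mem_higherRankNumericalRange_iff]
  simp only [Set.mem_iInter, mem_convexHull_biUnion_ellipseOf_iff hzh]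
  constructor
  · intro hμ J hJ ω
    by_contra! hcon
    obtain ⟨j, hj⟩ : J.Nonempty := Finset.card_pos.mp (by omega)
    have := add_card_le_of_isNegDirection hz hh hμ J (hcon j hj).1 hcon
    omega
  · intro hμ
    rcases eq_or_ne α μ with rfl | hα
    · exact (hasIsotropicSubspace_sub_alpha hh ∅ (by simp)).mono (by simp; omega)
    · refine (hasIsotropicSubspace_of_card_isNegDirection_le hz hh hcard hα (Fintype.card S - k)
        fun ω J hJ => ?_).mono (by omega)
      by_contra! hcon
      obtain ⟨J', hJ', hcard'⟩ := Finset.exists_subset_card_eq (Nat.succ_le_of_lt hcon)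
      obtain ⟨j, hj, hneg⟩ := hμ J' hcard' ω
      exact hneg (hJ j (hJ' hj))

/-- For `μ ≠ α` there is an `ω` with `Re (ω (α - μ)) < 0`, and then `Re (ω (A - μ))` is negative
definite on `ℂ^R`. -/
lemma higherRankNumericalRange_fromBlocks_subset (hz : D * C = Matrix.diagonal z)
    (hh : Cᴴ * C + D * Dᴴ = Matrix.diagonal fun j => (h j : ℂ)) (α β : ℂ) {k : ℕ}
    (hkS : Fintype.card S < k) :
    higherRankNumericalRange k (Matrix.fromBlocks (α • 1) C D (β • 1)) ⊆ {α} := by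
  intro μ hμ
  rw [mem_higherRankNumericalRange_iff] at hμ
  by_contra hne
  have hα : α - μ ≠ 0 := sub_ne_zero.mpr fun h => hne h.symm
  have := add_card_le_of_isNegDirection hz hh hμ (ω := -(α - μ)⁻¹) ∅
    (by rw [neg_mul, inv_mul_cancel₀ hα]; simp) (by simp)
  simp at this
  omega

lemma ncard_majorSq_eq_zero {S : Type*} [Fintype S] {z : S → ℂ} {h : S → ℝ}
    (hzh : ∀ j, 2 * ‖z j‖ ≤ h j) (α β : ℂ) :
    {j | majorSq α β (z j) (h j) = 0}.ncard =
      (Finset.univ.filter fun j => α = β ∧ h j = 0).card := by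
  rw [← Set.ncard_coe_finset]
  congr 1
  ext j
  simp [majorSq_eq_zero_iff (hzh j)]

/-- For `α ≠ β` the form of `A - α` has no isotropic vectors in `ℂ^S`. -/
lemma card_le_of_ne {α β : ℂ} (hne : α ≠ β) {k : ℕ} (hk : HasIsotropicSubspace
      (Matrix.fromBlocks (α • 1) C D (β • 1) - α • (1 : Matrix (R ⊕ S) (R ⊕ S) ℂ)) k) :
    k ≤ Fintype.card R := by
  rw [fromBlocks_sub_smul_one] at hk
  let Φ : (S → ℂ) →ₗ[ℂ] (R ⊕ S → ℂ) :=
    LinearMap.pi (Sum.elim (fun _ => (0 : (S → ℂ) →ₗ[ℂ] ℂ)) fun j => LinearMap.proj j)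
  have hΦ : ∀ v, Φ v = Sum.elim (0 : R → ℂ) v := fun v => by
    ext (i | i) <;> rfl
  have hinj : Function.Injective Φ := fun x y hxy => by
    ext j
    exact congrFun hxy (Sum.inr j)
  have := hk.add_finrank_le (N := LinearMap.range Φ) (by
    rintro _ ⟨v, rfl⟩ hv
    rw [hΦ, star_dotProduct_fromBlocks_mulVec, star_dotProduct_self v] at hv
    have h1 : ∑ j, ‖v j‖ ^ 2 = 0 := by
      have h2 : (β - α) * ((∑ j, ‖v j‖ ^ 2 : ℝ) : ℂ) = 0 := by simpa using hv
      exact_mod_cast (mul_eq_zero.mp h2).resolve_left (sub_ne_zero.mpr hne.symm)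
    have h3 : v = 0 := by
      ext j
      simpa using (Finset.sum_eq_zero_iff_of_nonneg fun i _ => by positivity).mp h1 j
        (Finset.mem_univ j)
    rw [h3, map_zero])
  rw [LinearMap.finrank_range_of_inj hinj, Fintype.card_sum, Module.finrank_pi] at this
  omega

lemma alpha_mem_higherRankNumericalRange_fromBlocks_iff (hz : D * C = Matrix.diagonal z)
    (hh : Cᴴ * C + D * Dᴴ = Matrix.diagonal fun j => (h j : ℂ)) (α β : ℂ) {k : ℕ} :
    α ∈ higherRankNumericalRange k (Matrix.fromBlocks (α • 1) C D (β • 1)) ↔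
      k ≤ Fintype.card R + {j | majorSq α β (z j) (h j) = 0}.ncard := by
  rw [mem_higherRankNumericalRange_iff, ncard_majorSq_eq_zero (two_mul_norm_le hz hh)]
  refine ⟨fun hα => ?_, fun hk => ?_⟩
  · rcases eq_or_ne α β with rfl | hne
    · have h1 := add_card_le_of_eq hz hh hα
      have h2 := Finset.card_filter_add_card_filter_not (s := Finset.univ) fun j => h j = 0
      simp only [true_and]
      rw [Finset.card_univ] at h2
      simp only [ne_eq] at h1
      omega
    · have h1 := card_le_of_ne hne hα
      simp only [hne, false_and, Finset.filter_false, Finset.card_empty, add_zero]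
      exact h1
  · exact (hasIsotropicSubspace_sub_alpha hh _ fun j hj => (Finset.mem_filter.mp hj).2).mono hk

end HigherRankRanges

/-! ### Duals of lines and conics -/

section Duals

open MvPolynomial

lemma eval_smul_of_isHomogeneous {g : MvPolynomial (Fin 3) ℂ} {d : ℕ} (hg : g.IsHomogeneous d)
    (c : ℂ) (p : Fin 3 → ℂ) : eval (c • p) g = c ^ d * eval p g := by
  rw [eval_eq, eval_eq, Finset.mul_sum]
  refine Finset.sum_congr rfl fun m hm => ?_
  have h1 : m.degree = d := by
    by_contra h
    exact mem_support_iff.mp hm (hg.coeff_eq_zero h)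
  simp only [Pi.smul_apply, smul_eq_mul, mul_pow, Finset.prod_mul_distrib,
    Finset.prod_pow_eq_pow_sum]
  rw [← h1, show m.degree = ∑ i ∈ m.support, m i from rfl]
  ring

/-- A polynomial of degree at most one is an affine function. -/
lemma exists_eval_eq_of_totalDegree_le_one {a : MvPolynomial (Fin 3) ℂ} (ha : a.totalDegree ≤ 1) :
    ∃ (a₀ : ℂ) (l : (Fin 3 → ℂ) →ₗ[ℂ] ℂ), ∀ p, eval p a = a₀ + l p := by
  have h1 : homogeneousComponent 1 a ∈ homogeneousSubmodule (Fin 3) ℂ 1 :=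
    homogeneousComponent_mem 1 a
  rw [homogeneousSubmodule_one_eq_span_X, Submodule.mem_span_range_iff_exists_fun] at h1
  obtain ⟨c, hc⟩ := h1
  have h2 : a = homogeneousComponent 0 a + homogeneousComponent 1 a := by
    conv_lhs => rw [← sum_homogeneousComponent a]
    rw [Finset.sum_subset (Finset.range_mono (show a.totalDegree + 1 ≤ 2 by omega))]
    · simp [Finset.sum_range_succ]
    · intro i _ hi
      exact homogeneousComponent_eq_zero _ _ (by simpa using hi)
  refine ⟨coeff 0 a, ∑ i, c i • LinearMap.proj i, fun p => ?_⟩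
  conv_lhs => rw [h2]
  rw [← hc, homogeneousComponent_zero]
  simp

/-- A quadratic form whose gradient vanishes only at the origin is irreducible: two linear forms
would have a common zero. -/
lemma irreducible_of_formGradient_ne_zero {f : MvPolynomial (Fin 3) ℂ} (hf : f.IsHomogeneous 2)
    (hgrad : ∀ p, formGradient f p = 0 → p = 0) : Irreducible f := by
  have hf0 : f ≠ 0 := by
    rintro rfl
    have := hgrad 1 (by ext i; simp [formGradient])
    simpa using congrFun this 0
  have hdeg := hf.totalDegree hf0
  refine ⟨fun hu => ?_, fun a b hab => ?_⟩
  · rw [isUnit_iff_totalDegree_of_isReduced] at hu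
    omega
  have ha0 : a ≠ 0 := by
    rintro rfl
    exact hf0 (by rw [hab, zero_mul])
  have hb0 : b ≠ 0 := by
    rintro rfl
    exact hf0 (by rw [hab, mul_zero])
  have hunit : ∀ c : MvPolynomial (Fin 3) ℂ, c ≠ 0 → c.totalDegree = 0 → IsUnit c := by
    intro c hc hc0
    rw [totalDegree_eq_zero_iff_eq_C] at hc0
    rw [hc0] at hc ⊢
    exact (isUnit_iff_ne_zero.mpr fun h => hc (by rw [h, C_0])).map C
  have hsum : a.totalDegree + b.totalDegree = 2 := by
    rw [← totalDegree_mul_of_isDomain ha0 hb0, ← hab, hdeg]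
  by_contra hcon
  rw [not_or] at hcon
  have h1 : a.totalDegree ≠ 0 := fun h => hcon.1 (hunit a ha0 h)
  have h2 : b.totalDegree ≠ 0 := fun h => hcon.2 (hunit b hb0 h)
  obtain ⟨a₀, l, hl⟩ := exists_eval_eq_of_totalDegree_le_one (a := a) (by omega)
  obtain ⟨b₀, m, hm⟩ := exists_eval_eq_of_totalDegree_le_one (a := b) (by omega)
  have hfp : ∀ p, eval p f = (a₀ + l p) * (b₀ + m p) := fun p => by
    rw [hab, map_mul, hl, hm]
  have hneg : ∀ p, a₀ * m p + b₀ * l p = 0 := fun p => by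
    have h3 := eval_smul_of_isHomogeneous hf (-1) p
    rw [hfp, hfp, map_smul, map_smul] at h3
    simp only [smul_eq_mul] at h3
    linear_combination -h3 / 2
  have h00 : a₀ * b₀ = 0 := by
    have h3 := eval_smul_of_isHomogeneous hf 0 0
    rw [hfp] at h3
    simpa using h3
  have hab0 : a₀ = 0 ∧ b₀ = 0 := by
    rcases mul_eq_zero.mp h00 with h | h
    · refine ⟨h, ?_⟩
      by_contra hb
      refine ha0 (funext fun p => ?_)
      have := hneg p
      rw [h, zero_mul, zero_add] at this
      rw [hl, h, (mul_eq_zero.mp this).resolve_left hb]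
      simp
    · refine ⟨?_, h⟩
      by_contra ha
      refine hb0 (funext fun p => ?_)
      have := hneg p
      rw [h, zero_mul, add_zero] at this
      rw [hm, h, (mul_eq_zero.mp this).resolve_left ha]
      simp
  obtain ⟨p, hp, hp0⟩ := Submodule.exists_mem_ne_zero_of_ne_bot
    (LinearMap.ker_ne_bot_of_finrank_lt (f := l.prod m) (by simp))
  replace hp : l p = 0 ∧ m p = 0 := Prod.mk_eq_zero.mp (LinearMap.mem_ker.mp hp)
  refine hp0 (hgrad p ?_)
  ext i
  simp only [formGradient, hab, Derivation.leibniz, map_add, smul_eq_mul, map_mul, hl, hm, hab0.1,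
    hab0.2, hp.1, hp.2, Pi.zero_apply]
  ring

/-- The real affine part of the dual of the curve `f = 0`. -/
def realDual (f : MvPolynomial (Fin 3) ℂ) : Set ℂ :=
  {w | ![(w.re : ℂ), (w.im : ℂ), 1] ∈ dualCurve f}

lemma dualCurve_subset_of_associated {f g : MvPolynomial (Fin 3) ℂ} (h : Associated f g) :
    dualCurve f ⊆ dualCurve g := by
  obtain ⟨u, rfl⟩ := h
  obtain ⟨c, hc, hcu⟩ := isUnit_iff_eq_C_of_isReduced.mp u.isUnit
  have hc0 : c ≠ 0 := hc.ne_zero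
  intro q hq d e he htan
  refine hq d e he fun p hp hgrad => ?_
  have h1 : formGradient (f * u) p = c • formGradient f p := by
    ext i
    simp [formGradient, hcu, Derivation.leibniz]
  have h2 := htan p (by simp [hp]) (by rw [h1]; exact smul_ne_zero hc0 hgrad)
  rw [h1, eval_smul_of_isHomogeneous he] at h2
  exact (mul_eq_zero.mp h2).resolve_left (pow_ne_zero d hc0)

/-- The union of the real affine parts of the duals of the components of the curve `p = 0`; the
Kippenhahn curve is the case of the Kippenhahn polynomial. -/
def componentDuals (p : MvPolynomial (Fin 3) ℂ) : Set ℂ :=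
  {w | ∃ f, Irreducible f ∧ f ∣ p ∧ ![(w.re : ℂ), (w.im : ℂ), 1] ∈ dualCurve f}

lemma componentDuals_one : componentDuals 1 = ∅ := by
  ext w
  simp only [componentDuals, Set.mem_ofPred_eq, Set.mem_empty_iff_false, iff_false]
  rintro ⟨f, hf, hf1, -⟩
  exact hf.not_isUnit (isUnit_of_dvd_one hf1)

lemma componentDuals_mul (p q : MvPolynomial (Fin 3) ℂ) :
    componentDuals (p * q) = componentDuals p ∪ componentDuals q := by
  ext w
  constructor
  · rintro ⟨f, hf, hpq, hw⟩
    rcases hf.prime.dvd_or_dvd hpq with h | h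
    · exact Or.inl ⟨f, hf, h, hw⟩
    · exact Or.inr ⟨f, hf, h, hw⟩
  · rintro (⟨f, hf, h, hw⟩ | ⟨f, hf, h, hw⟩)
    · exact ⟨f, hf, h.mul_right q, hw⟩
    · exact ⟨f, hf, h.mul_left p, hw⟩

lemma componentDuals_prod {S : Type*} (J : Finset S) (p : S → MvPolynomial (Fin 3) ℂ) :
    componentDuals (∏ j ∈ J, p j) = ⋃ j ∈ J, componentDuals (p j) := by
  classical
  induction J using Finset.induction_on with
  | empty => simp [componentDuals_one]
  | insert a J ha ih =>
    rw [Finset.prod_insert ha, componentDuals_mul, ih, Finset.set_biUnion_insert]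

lemma componentDuals_pow (p : MvPolynomial (Fin 3) ℂ) {n : ℕ} (hn : n ≠ 0) :
    componentDuals (p ^ n) = componentDuals p := by
  ext w
  constructor
  · rintro ⟨f, hf, h, hw⟩
    exact ⟨f, hf, hf.prime.dvd_of_dvd_pow h, hw⟩
  · rintro ⟨f, hf, h, hw⟩
    exact ⟨f, hf, h.trans (dvd_pow_self p hn), hw⟩

lemma componentDuals_of_irreducible {p : MvPolynomial (Fin 3) ℂ} (hp : Irreducible p) :
    componentDuals p = realDual p := by
  ext w
  constructor
  · rintro ⟨f, hf, h, hw⟩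
    exact dualCurve_subset_of_associated (hf.associated_of_dvd hp h) hw
  · exact fun hw => ⟨p, hp, dvd_rfl, hw⟩

/-- The pencil of lines through the point `w`, as a linear form in line coordinates. -/
noncomputable def pointForm (w : ℂ) : MvPolynomial (Fin 3) ℂ :=
  X 2 + C (w.re : ℂ) * X 0 + C (w.im : ℂ) * X 1

lemma isHomogeneous_pointForm (w : ℂ) : (pointForm w).IsHomogeneous 1 :=
  ((isHomogeneous_X _ _).add (isHomogeneous_C_mul_X _ _)).add (isHomogeneous_C_mul_X _ _)

lemma formGradient_pointForm (w : ℂ) (p : Fin 3 → ℂ) :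
    formGradient (pointForm w) p = ![(w.re : ℂ), (w.im : ℂ), 1] := by
  ext i
  fin_cases i <;> simp [formGradient, pointForm, pderiv_X]

lemma pointForm_ne_zero (w : ℂ) : pointForm w ≠ 0 := by
  intro h
  have := congrArg (eval ![0, 0, 1]) h
  simp [pointForm] at this

lemma irreducible_pointForm (w : ℂ) : Irreducible (pointForm w) := by
  refine irreducible_of_totalDegree_eq_one
    ((isHomogeneous_pointForm w).totalDegree (pointForm_ne_zero w)) fun x hx => ?_
  have h1 : coeff (Finsupp.single 2 1) (pointForm w) = 1 := by
    simp [pointForm, coeff_C_mul, coeff_X, Finsupp.single_left_inj]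
  exact isUnit_of_dvd_one (h1 ▸ hx (Finsupp.single 2 1))

/-- The dual of a line is a point. -/
lemma componentDuals_pointForm (w : ℂ) : componentDuals (pointForm w) = {w} := by
  rw [componentDuals_of_irreducible (irreducible_pointForm w)]
  have hne : (![(w.re : ℂ), (w.im : ℂ), 1] : Fin 3 → ℂ) ≠ 0 := fun h => by
    simpa using congrFun h 2
  ext v
  constructor
  · intro hv
    have h1 := hv 1 (X 0 - C (w.re : ℂ) * X 2)
      ((isHomogeneous_X _ _).sub (isHomogeneous_C_mul_X _ _)) fun p _ _ => by
        simp [formGradient_pointForm]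
    have h2 := hv 1 (X 1 - C (w.im : ℂ) * X 2)
      ((isHomogeneous_X _ _).sub (isHomogeneous_C_mul_X _ _)) fun p _ _ => by
        simp [formGradient_pointForm]
    simp [sub_eq_zero] at h1 h2
    exact Complex.ext h1 h2
  · rintro rfl d g _ h
    have := h 0 (by simp [pointForm]) (by rw [formGradient_pointForm]; exact hne)
    rwa [formGradient_pointForm] at this

/-- The conic in line coordinates that is dual to the ellipse with centre `c`, squared half focal
length `D` and squared axes `k ± 2 |D|`. -/
noncomputable def dualConic (c D : ℂ) (k : ℝ) : MvPolynomial (Fin 3) ℂ :=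
  pointForm c ^ 2 - C (1 / 4) * (C (k + 2 * D.re : ℂ) * X 0 ^ 2 + C (k - 2 * D.re : ℂ) * X 1 ^ 2 +
    C (4 * D.im : ℂ) * (X 0 * X 1))

lemma isHomogeneous_dualConic (c D : ℂ) (k : ℝ) : (dualConic c D k).IsHomogeneous 2 := by
  refine ((isHomogeneous_pointForm c).pow 2).sub (IsHomogeneous.C_mul ?_ _)
  exact ((isHomogeneous_C_mul_X_pow _ _ _).add (isHomogeneous_C_mul_X_pow _ _ _)).add
    (((isHomogeneous_X _ _).mul (isHomogeneous_X _ _)).C_mul _)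

lemma formGradient_dualConic (c D : ℂ) (k : ℝ) (p : Fin 3 → ℂ) :
    formGradient (dualConic c D k) p =
      ![2 * (p 2 + c.re * p 0 + c.im * p 1) * c.re -
          ((k + 2 * D.re) * p 0 + 2 * D.im * p 1) / 2,
        2 * (p 2 + c.re * p 0 + c.im * p 1) * c.im -
          (2 * D.im * p 0 + (k - 2 * D.re) * p 1) / 2,
        2 * (p 2 + c.re * p 0 + c.im * p 1)] := by
  ext i
  fin_cases i <;>
  · simp [formGradient, dualConic, pointForm, pderiv_X, Derivation.leibniz,
      Derivation.leibniz_pow]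
    try ring

lemma eval_dualConic (c D : ℂ) (k : ℝ) (p : Fin 3 → ℂ) :
    eval p (dualConic c D k) = (p 2 + c.re * p 0 + c.im * p 1) ^ 2 -
      ((k + 2 * D.re) * p 0 ^ 2 + (k - 2 * D.re) * p 1 ^ 2 + 4 * D.im * (p 0 * p 1)) / 4 := by
  simp [dualConic, pointForm]
  ring

lemma irreducible_dualConic {c D : ℂ} {k : ℝ} (hN : k ^ 2 - 4 * ‖D‖ ^ 2 ≠ 0) :
    Irreducible (dualConic c D k) := by
  refine irreducible_of_formGradient_ne_zero (isHomogeneous_dualConic c D k) fun p hp => ?_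
  rw [formGradient_dualConic] at hp
  have h0 := congrFun hp 0
  have h1 := congrFun hp 1
  have h2 := congrFun hp 2
  simp only [Matrix.cons_val_zero, Matrix.cons_val_one, Matrix.cons_val, Pi.zero_apply] at h0 h1 h2
  have hN' : (k ^ 2 - 4 * (D.re ^ 2 + D.im ^ 2) : ℂ) ≠ 0 := by
    rw [Complex.sq_norm, Complex.normSq_apply] at hN
    intro h
    apply hN
    have : k ^ 2 - 4 * (D.re ^ 2 + D.im ^ 2) = 0 := by exact_mod_cast h
    linarith
  have hp0 : p 0 = 0 := by
    refine (mul_eq_zero.mp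
      (?_ : (k ^ 2 - 4 * (D.re ^ 2 + D.im ^ 2) : ℂ) * p 0 = 0)).resolve_left hN'
    linear_combination (-2 * (k - 2 * D.re)) * h0 + 4 * D.im * h1 +
      (2 * (k - 2 * D.re) * c.re - 4 * D.im * c.im) * h2
  have hp1 : p 1 = 0 := by
    refine (mul_eq_zero.mp
      (?_ : (k ^ 2 - 4 * (D.re ^ 2 + D.im ^ 2) : ℂ) * p 1 = 0)).resolve_left hN'
    linear_combination (-2 * (k + 2 * D.re)) * h1 + 4 * D.im * h0 +
      (2 * (k + 2 * D.re) * c.im - 4 * D.im * c.re) * h2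
  have hp2 : p 2 = 0 := by
    rw [hp0, hp1] at h2
    simpa using h2
  ext i
  fin_cases i
  exacts [hp0, hp1, hp2]

/-- The dual of a nonsingular conic is given by the adjoint of its quadratic form. -/
lemma mem_componentDuals_dualConic_iff {c D w : ℂ} {k : ℝ} (hN : k ^ 2 - 4 * ‖D‖ ^ 2 ≠ 0) :
    w ∈ componentDuals (dualConic c D k) ↔
      k * ‖w - c‖ ^ 2 - 2 * ((w - c) ^ 2 * star D).re = (k ^ 2 - 4 * ‖D‖ ^ 2) / 4 := by
  rw [componentDuals_of_irreducible (irreducible_dualConic hN)]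
  have hnorm : ‖D‖ ^ 2 = D.re ^ 2 + D.im ^ 2 := by
    rw [Complex.sq_norm, Complex.normSq_apply]
    ring
  have hlhs : k * ‖w - c‖ ^ 2 - 2 * ((w - c) ^ 2 * star D).re =
      (k - 2 * D.re) * (w.re - c.re) ^ 2 + (k + 2 * D.re) * (w.im - c.im) ^ 2 -
        4 * D.im * ((w.re - c.re) * (w.im - c.im)) := by
    rw [Complex.sq_norm, Complex.normSq_apply]
    simp only [Complex.sub_re, Complex.sub_im, Complex.mul_re, Complex.mul_im, pow_two,
      Complex.star_def, Complex.conj_re, Complex.conj_im]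
    ring
  rw [hlhs]
  constructor
  · intro hw
    -- the adjoint quadratic form vanishes at all tangent lines
    let Y₀ : MvPolynomial (Fin 3) ℂ := X 0 - C (c.re : ℂ) * X 2
    let Y₁ : MvPolynomial (Fin 3) ℂ := X 1 - C (c.im : ℂ) * X 2
    have hY₀ : Y₀.IsHomogeneous 1 := (isHomogeneous_X _ _).sub (isHomogeneous_C_mul_X _ _)
    have hY₁ : Y₁.IsHomogeneous 1 := (isHomogeneous_X _ _).sub (isHomogeneous_C_mul_X _ _)
    have h1 := hw 2 (C (k - 2 * D.re : ℂ) * Y₀ ^ 2 + C (k + 2 * D.re : ℂ) * Y₁ ^ 2 -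
        C (4 * D.im : ℂ) * (Y₀ * Y₁) - C ((k ^ 2 - 4 * (D.re ^ 2 + D.im ^ 2)) / 4 : ℂ) * X 2 ^ 2)
      (((((hY₀.pow 2).C_mul _).add ((hY₁.pow 2).C_mul _)).sub ((hY₀.mul hY₁).C_mul _)).sub
        (isHomogeneous_C_mul_X_pow _ _ _)) fun p hp _ => by
        rw [eval_dualConic] at hp
        rw [formGradient_dualConic]
        simp only [Y₀, Y₁, map_add, map_sub, map_mul, map_pow, eval_C, eval_X,
          Matrix.cons_val_zero, Matrix.cons_val_one, Matrix.cons_val]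
        linear_combination (-(k ^ 2 - 4 * (D.re ^ 2 + D.im ^ 2)) : ℂ) * hp
    simp only [Y₀, Y₁, map_add, map_sub, map_mul, map_pow, eval_C, eval_X,
      Matrix.cons_val_zero, Matrix.cons_val_one, Matrix.cons_val] at h1
    rw [hnorm, ← Complex.ofReal_inj]
    push_cast
    linear_combination h1
  · intro hw d g _ h
    rw [hnorm] at hw hN
    have hw' : (((k - 2 * D.re) * (w.re - c.re) ^ 2 + (k + 2 * D.re) * (w.im - c.im) ^ 2 -
        4 * D.im * ((w.re - c.re) * (w.im - c.im)) : ℝ) : ℂ) =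
        (((k ^ 2 - 4 * (D.re ^ 2 + D.im ^ 2)) / 4 : ℝ) : ℂ) := congrArg _ hw
    push_cast at hw'
    have hN' : (k ^ 2 - 4 * (D.re ^ 2 + D.im ^ 2) : ℂ) ≠ 0 := by exact_mod_cast hN
    set N : ℂ := k ^ 2 - 4 * (D.re ^ 2 + D.im ^ 2) with hNdef
    -- the point of contact of the tangent line
    let u : ℂ := -(2 / N) * ((k - 2 * D.re) * (w.re - c.re) - 2 * D.im * (w.im - c.im))
    let v : ℂ := -(2 / N) * ((k + 2 * D.re) * (w.im - c.im) - 2 * D.im * (w.re - c.re))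
    have hu : N * u = -2 * ((k - 2 * D.re) * (w.re - c.re) - 2 * D.im * (w.im - c.im)) := by
      simp only [u]
      field_simp
    have hv : N * v = -2 * ((k + 2 * D.re) * (w.im - c.im) - 2 * D.im * (w.re - c.re)) := by
      simp only [v]
      field_simp
    clear_value u v
    have hgu : (k + 2 * D.re) * u + 2 * D.im * v = -2 * (w.re - c.re : ℂ) := by
      refine mul_left_cancel₀ hN' ?_
      linear_combination (k + 2 * D.re : ℂ) * hu + 2 * D.im * hv -
        2 * (w.re - c.re : ℂ) * hNdef
    have hgv : 2 * D.im * u + (k - 2 * D.re) * v = -2 * (w.im - c.im : ℂ) := by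
      refine mul_left_cancel₀ hN' ?_
      linear_combination (k - 2 * D.re : ℂ) * hv + 2 * D.im * hu -
        2 * (w.im - c.im : ℂ) * hNdef
    have hgrad : formGradient (dualConic c D k) ![u, v, 1 / 2 - c.re * u - c.im * v] =
        ![(w.re : ℂ), (w.im : ℂ), 1] := by
      rw [formGradient_dualConic]
      simp only [Matrix.cons_val_zero, Matrix.cons_val_one, Matrix.cons_val]
      congr! 1
      · linear_combination -hgu / 2
      · congr! 1
        · linear_combination -hgv / 2
        · congr! 1
          ring
    rw [← hgrad]
    refine h _ ?_ ?_
    · rw [eval_dualConic]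
      simp only [Matrix.cons_val_zero, Matrix.cons_val_one, Matrix.cons_val]
      refine mul_left_cancel₀ hN' ?_
      linear_combination (-N * u / 4) * hgu - (N * v / 4) * hgv + (w.re - c.re : ℂ) / 2 * hu +
        (w.im - c.im : ℂ) / 2 * hv - hw'
    · rw [hgrad]
      exact fun h => by simpa using congrFun h 2

lemma dualConic_eq_mul {c ρ : ℂ} :
    dualConic c (ρ ^ 2) (2 * ‖ρ‖ ^ 2) = pointForm (c + ρ) * pointForm (c - ρ) := by
  refine MvPolynomial.funext fun p => ?_
  rw [eval_dualConic]
  rw [Complex.sq_norm, Complex.normSq_apply]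
  simp only [pointForm, map_add, map_mul, eval_C, eval_X, pow_two, Complex.mul_re,
    Complex.mul_im, Complex.add_re, Complex.add_im, Complex.sub_re, Complex.sub_im]
  push_cast
  ring

/-- The curve `dualConic c (ρ ^ 2) k = 0` is dual to the ellipse, also if this is a pair of
foci: then the quadratic form is a product of two linear forms. -/
lemma componentDuals_dualConic {c ρ : ℂ} {k : ℝ} (hk : 2 * ‖ρ‖ ^ 2 ≤ k) :
    componentDuals (dualConic c (ρ ^ 2) k) = ellipse c ρ k := by
  rcases hk.lt_or_eq with hk' | rfl
  · ext w
    have h4 : ‖ρ ^ 2‖ ^ 2 = ‖ρ‖ ^ 4 := by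
      rw [norm_pow]
      ring
    rw [mem_componentDuals_dualConic_iff, mem_ellipse_iff hk', h4]
    have := sq_nonneg ‖ρ‖
    rw [h4]
    nlinarith
  · rw [dualConic_eq_mul, componentDuals_mul, componentDuals_pointForm, componentDuals_pointForm,
      ellipse, if_neg (lt_irrefl _)]
    rfl

end Duals

/-! ### The Kippenhahn curve of the block matrix -/

section Kippenhahn

lemma eval_kippenhahnPolynomial {ι : Type*} [Fintype ι] [DecidableEq ι] (A : Matrix ι ι ℂ)
    (p : Fin 3 → ℂ) : MvPolynomial.eval p (kippenhahnPolynomial A) =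
      (p 0 • hermitianRe A + p 1 • hermitianIm A + p 2 • 1).det := by
  rw [kippenhahnPolynomial, RingHom.map_det]
  congr 1
  ext i j
  by_cases hij : i = j
  · subst hij
    simp
  · simp [hij]

lemma kippenhahnPolynomial_conj {ι : Type*} [Fintype ι] [DecidableEq ι] {U : Matrix ι ι ℂ}
    (hU : U ∈ Matrix.unitaryGroup ι ℂ) (A : Matrix ι ι ℂ) :
    kippenhahnPolynomial (Uᴴ * A * U) = kippenhahnPolynomial A := by
  have h1 : Uᴴ * U = 1 := Matrix.mem_unitaryGroup_iff'.mp hU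
  refine MvPolynomial.funext fun p => ?_
  rw [eval_kippenhahnPolynomial, eval_kippenhahnPolynomial]
  have h2 : p 0 • hermitianRe (Uᴴ * A * U) + p 1 • hermitianIm (Uᴴ * A * U) + p 2 • 1 =
      Uᴴ * (p 0 • hermitianRe A + p 1 • hermitianIm A + p 2 • 1) * U := by
    simp only [hermitianRe, hermitianIm, Matrix.conjTranspose_mul,
      Matrix.conjTranspose_conjTranspose, Matrix.mul_add, Matrix.add_mul, Matrix.mul_sub,
      Matrix.sub_mul, Matrix.mul_smul, Matrix.smul_mul, Matrix.mul_one, h1, Matrix.mul_assoc]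
  rw [h2, Matrix.det_mul, Matrix.det_mul, mul_right_comm, ← Matrix.det_mul, h1, Matrix.det_one,
    one_mul]

variable {R S : Type*} [Fintype R] [Fintype S] [DecidableEq R] [DecidableEq S]

/-- The determinant by a Schur complement, free of division and therefore valid also for
`s = 0`. -/
lemma pow_mul_det_fromBlocks_smul_one (s t : ℂ) (X : Matrix R S ℂ) (Y : Matrix S R ℂ) :
    s ^ Fintype.card S * (Matrix.fromBlocks (s • 1) X Y (t • 1)).det =
      s ^ Fintype.card R * ((s * t) • 1 - Y * X).det := by
  have h : Matrix.fromBlocks (1 : Matrix R R ℂ) 0 (-Y) (s • 1) *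
      Matrix.fromBlocks (s • 1) X Y (t • 1) =
        Matrix.fromBlocks (s • 1) X 0 ((s * t) • 1 - Y * X) := by
    rw [Matrix.fromBlocks_multiply]
    congr 1
    · simp
    · simp
    · simp
    · simp [smul_smul, sub_eq_add_neg, add_comm, mul_comm]
  have h2 := congrArg Matrix.det h
  rwa [Matrix.det_mul, Matrix.det_fromBlocks_zero₁₂, Matrix.det_fromBlocks_zero₂₁, Matrix.det_one,
    one_mul, Matrix.det_smul, Matrix.det_smul, Matrix.det_one, Matrix.det_one, mul_one,
    mul_one] at h2

/-- The quadratic factor of the Kippenhahn polynomial that belongs to the joint eigenvalues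
`z`, `h`, in the form in which the Schur complement produces it. -/
lemma eval_dualConic_eq (α β z : ℂ) (h : ℝ) (p : Fin 3 → ℂ) :
    MvPolynomial.eval p
        (dualConic ((α + β) / 2) (halfFocal α β z ^ 2) (‖α - β‖ ^ 2 / 2 + h)) =
      (p 2 + α.re * p 0 + α.im * p 1) * (p 2 + β.re * p 0 + β.im * p 1) -
        ((p 0 - Complex.I * p 1) ^ 2 * z + (p 0 + Complex.I * p 1) ^ 2 * star z +
          (p 0 ^ 2 + p 1 ^ 2) * h) / 4 := by
  have hz : (p 0 - Complex.I * p 1) ^ 2 * z + (p 0 + Complex.I * p 1) ^ 2 * star z =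
      2 * z.re * (p 0 ^ 2 - p 1 ^ 2) + 4 * z.im * (p 0 * p 1) := by
    have h1 := Complex.re_add_im z
    have h2 : star z = z.re - z.im * Complex.I := by
      apply Complex.ext <;> simp
    rw [h2]
    nth_rewrite 1 [← h1]
    linear_combination (2 * z.re * p 1 ^ 2 - 4 * z.im * p 0 * p 1) * Complex.I_sq
  rw [eval_dualConic, halfFocal_sq, discr, hz, Complex.sq_norm, Complex.normSq_apply]
  simp only [Complex.div_ofNat_re, Complex.div_ofNat_im, Complex.add_re, Complex.add_im, pow_two,
    Complex.mul_re, Complex.mul_im, Complex.sub_re, Complex.sub_im, Complex.re_ofNat,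
    Complex.im_ofNat]
  push_cast
  ring

/-- Factorization of the Kippenhahn polynomial. The Schur complement of the scalar block
`α` of `u Re A + v Im A + t` is a diagonal matrix. -/
lemma kippenhahnPolynomial_fromBlocks {C : Matrix R S ℂ} {D : Matrix S R ℂ} {z : S → ℂ}
    {h : S → ℝ} (hz : D * C = Matrix.diagonal z)
    (hh : Cᴴ * C + D * Dᴴ = Matrix.diagonal fun j => (h j : ℂ))
    (hcard : Fintype.card S ≤ Fintype.card R) (α β : ℂ) :
    kippenhahnPolynomial (Matrix.fromBlocks (α • 1) C D (β • 1)) =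
      pointForm α ^ (Fintype.card R - Fintype.card S) *
        ∏ j, dualConic ((α + β) / 2) (halfFocal α β (z j) ^ 2) (‖α - β‖ ^ 2 / 2 + h j) := by
  have hz' : Cᴴ * Dᴴ = Matrix.diagonal (star z) := by
    rw [← Matrix.conjTranspose_mul, hz, Matrix.diagonal_conjTranspose]
  refine mul_left_cancel₀ (pow_ne_zero (Fintype.card S) (pointForm_ne_zero α)) ?_
  rw [← mul_assoc, ← pow_add, Nat.add_sub_cancel' hcard]
  refine MvPolynomial.funext fun p => ?_
  rw [map_mul, map_mul, map_pow, map_pow, map_prod, eval_kippenhahnPolynomial]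
  simp only [eval_dualConic_eq]
  set ω := p 0 - Complex.I * p 1 with hω
  set ω' := p 0 + Complex.I * p 1 with hω'
  have hα : ∀ γ : ℂ, MvPolynomial.eval p (pointForm γ) =
      p 2 + γ.re * p 0 + γ.im * p 1 := fun γ => by
    simp [pointForm]
  have hblock : p 0 • hermitianRe (Matrix.fromBlocks (α • 1) C D (β • 1)) +
      p 1 • hermitianIm (Matrix.fromBlocks (α • 1) C D (β • 1)) +
        p 2 • (1 : Matrix (R ⊕ S) (R ⊕ S) ℂ) =
      Matrix.fromBlocks ((p 2 + α.re * p 0 + α.im * p 1) • 1)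
        ((1 / 2 : ℂ) • (ω • C + ω' • Dᴴ)) ((1 / 2 : ℂ) • (ω • D + ω' • Cᴴ))
        ((p 2 + β.re * p 0 + β.im * p 1) • 1) := by
    have hI : (1 / (2 * Complex.I) : ℂ) = -Complex.I / 2 := by
      rw [div_mul_eq_div_div, Complex.div_I]
      ring
    have hdiag : ∀ γ : ℂ, p 0 * (1 / 2 * (γ + star γ)) +
        p 1 * (1 / (2 * Complex.I) * (γ - star γ)) + p 2 = p 2 + γ.re * p 0 + γ.im * p 1 := by
      intro γ
      rw [hI, Complex.star_def, Complex.add_conj, Complex.sub_conj]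
      push_cast
      linear_combination (-p 1 * γ.im) * Complex.I_sq
    have hoff : ∀ x y : ℂ, p 0 * (1 / 2 * (x + y)) + p 1 * (1 / (2 * Complex.I) * (x - y)) =
        1 / 2 * (ω * x + ω' * y) := by
      intro x y
      rw [hI, hω, hω']
      ring
    ext (i | i) (j | j)
    · by_cases hij : i = j
      · subst hij
        simpa [hermitianRe, hermitianIm, mul_add] using hdiag α
      · simp [hermitianRe, hermitianIm, hij, Ne.symm hij]
    · simpa [hermitianRe, hermitianIm, mul_add] using hoff (C i j) (star (D j i))
    · simpa [hermitianRe, hermitianIm, mul_add] using hoff (D i j) (star (C j i))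
    · by_cases hij : i = j
      · subst hij
        simpa [hermitianRe, hermitianIm, mul_add] using hdiag β
      · simp [hermitianRe, hermitianIm, hij, Ne.symm hij]
  have hprod : (1 / 2 : ℂ) • (ω • D + ω' • Cᴴ) * (1 / 2 : ℂ) • (ω • C + ω' • Dᴴ) =
      Matrix.diagonal fun j => (ω ^ 2 * z j + ω' ^ 2 * star (z j) +
        (p 0 ^ 2 + p 1 ^ 2) * h j) / 4 := by
    have h1 : (1 / 2 : ℂ) • (ω • D + ω' • Cᴴ) * (1 / 2 : ℂ) • (ω • C + ω' • Dᴴ) =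
        (ω ^ 2 / 4) • (D * C) + (ω' ^ 2 / 4) • (Cᴴ * Dᴴ) +
          (ω * ω' / 4) • (Cᴴ * C + D * Dᴴ) := by
      simp only [Matrix.smul_mul, Matrix.mul_smul, Matrix.add_mul, Matrix.mul_add]
      module
    have h2 : ω * ω' = p 0 ^ 2 + p 1 ^ 2 := by
      rw [hω, hω']
      linear_combination (-p 1 ^ 2) * Complex.I_sq
    rw [h1, hz, hz', hh, ← Matrix.diagonal_smul, ← Matrix.diagonal_smul, ← Matrix.diagonal_smul,
      Matrix.diagonal_add, Matrix.diagonal_add, h2]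
    congr 1
    ext j
    simp only [Pi.smul_apply, smul_eq_mul, Pi.star_apply]
    ring
  rw [hblock, hα, pow_mul_det_fromBlocks_smul_one, hprod, ← Matrix.diagonal_one,
    ← Matrix.diagonal_smul, Matrix.diagonal_sub, Matrix.det_diagonal]
  simp

lemma kippenhahnCurve_fromBlocks {C : Matrix R S ℂ} {D : Matrix S R ℂ} {z : S → ℂ}
    {h : S → ℝ} (hz : D * C = Matrix.diagonal z)
    (hh : Cᴴ * C + D * Dᴴ = Matrix.diagonal fun j => (h j : ℂ))
    (hcard : Fintype.card S ≤ Fintype.card R) (α β : ℂ) :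
    kippenhahnCurve (Matrix.fromBlocks (α • 1) C D (β • 1)) =
      componentDuals (pointForm α ^ (Fintype.card R - Fintype.card S)) ∪
        ⋃ j, ellipseOf α β (z j) (h j) := by
  change componentDuals (kippenhahnPolynomial _) = _
  rw [kippenhahnPolynomial_fromBlocks hz hh hcard, componentDuals_mul, componentDuals_prod]
  congr 1
  simp only [Finset.mem_univ, Set.iUnion_true]
  refine Set.iUnion_congr fun j => componentDuals_dualConic ?_
  have := minorSq_nonneg (α := α) (β := β) (two_mul_norm_le hz hh j)
  rw [minorSq_eq] at this
  linarith

end Kippenhahn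

/-! ### Simultaneous diagonalization -/

section JointEigenvalues

variable {ι : Type*} [Fintype ι] [DecidableEq ι]

open Module.End in
/-- Commuting Hermitian matrices have an orthonormal basis of common eigenvectors. -/
lemma exists_orthonormalBasis_of_commute {T : Fin 3 → Matrix ι ι ℂ}
    (hT : ∀ i, (T i).IsHermitian) (hcomm : ∀ i j, Commute (T i) (T j)) :
    ∃ (b : OrthonormalBasis ι ℂ (EuclideanSpace ℂ ι)) (γ : ι → Fin 3 → ℂ),
      ∀ l j, Matrix.toEuclideanLin (T l) (b j) = γ j l • b j := by
  classical
  let f : Fin 3 → EuclideanSpace ℂ ι →ₗ[ℂ] EuclideanSpace ℂ ι := fun l =>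
    Matrix.toEuclideanLin (T l)
  have hf : ∀ l, (f l).IsSymmetric := fun l => Matrix.isSymmetric_toEuclideanLin_iff.mpr (hT l)
  have hfc : Pairwise (Function.onFun Commute f) := fun i j _ => by
    change f i * f j = f j * f i
    ext1 x
    simp only [f, Module.End.mul_apply, Matrix.toLpLin_apply, Matrix.mulVec_mulVec, (hcomm i j).eq]
  let V : (Fin 3 → ℂ) → Submodule ℂ (EuclideanSpace ℂ ι) := fun γ => ⨅ l, eigenspace (f l) (γ l)
  have hint : DirectSum.IsInternal V :=
    LinearMap.IsSymmetric.directSum_isInternal_of_pairwise_commute hf hfc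
  have horth := LinearMap.IsSymmetric.orthogonalFamily_iInf_eigenspaces hf
  let B := hint.collectedBasis fun γ => (stdOrthonormalBasis ℂ (V γ)).toBasis
  have hB : Orthonormal ℂ B := by
    rw [show ⇑B = _ from hint.collectedBasis_coe _]
    simpa using horth.orthonormal_sigma_orthonormal
      (v_family := fun γ => stdOrthonormalBasis ℂ (V γ))
        fun γ => (stdOrthonormalBasis ℂ (V γ)).orthonormal
  have : Fintype (Σ γ, Fin (Module.finrank ℂ (V γ))) := FiniteDimensional.fintypeBasisIndex B
  let e : (Σ γ, Fin (Module.finrank ℂ (V γ))) ≃ ι := Fintype.equivOfCardEq (by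
    rw [← Module.finrank_eq_card_basis B]
    simp)
  let b := (B.toOrthonormalBasis hB).reindex e
  refine ⟨b, fun j => (e.symm j).1, fun l j => ?_⟩
  have hmem : b j ∈ V (e.symm j).1 := by
    rw [OrthonormalBasis.reindex_apply, Module.Basis.coe_toOrthonormalBasis]
    exact hint.collectedBasis_mem (fun γ => (stdOrthonormalBasis ℂ (V γ)).toBasis) (e.symm j)
  exact mem_eigenspace_iff.mp ((Submodule.mem_iInf _).mp hmem l)

/-- A normal matrix and a Hermitian matrix that commute are diagonalized by one unitary matrix:
`Re Z`, `Im Z` and `H` are commuting Hermitian matrices. -/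
lemma exists_isJointEigenvalues {Z H : Matrix ι ι ℂ} (hZ : IsStarNormal Z) (hH : H.IsHermitian)
    (hZH : Commute Z H) : ∃ z h, IsJointEigenvalues Z H z h := by
  have hZ' : Zᴴ * Z = Z * Zᴴ := hZ.star_comm_self
  have hZH' : Z * H = H * Z := hZH
  have hZsH : Zᴴ * H = H * Zᴴ := by
    have h1 := congrArg Matrix.conjTranspose hZH'
    rw [Matrix.conjTranspose_mul, Matrix.conjTranspose_mul, hH.eq] at h1
    exact h1.symm
  have hre : (hermitianRe Z).IsHermitian := by
    rw [Matrix.IsHermitian, hermitianRe]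
    simp [add_comm]
  have him : (hermitianIm Z).IsHermitian := by
    rw [Matrix.IsHermitian, hermitianIm, Matrix.conjTranspose_smul, Matrix.conjTranspose_sub,
      Matrix.conjTranspose_conjTranspose, ← neg_sub Z, smul_neg, ← neg_smul]
    congr 1
    simp
  have hri : Commute (hermitianRe Z) (hermitianIm Z) := by
    refine Commute.smul_left (Commute.smul_right ?_ _) _
    exact Commute.add_left (Commute.sub_right rfl hZ'.symm) (Commute.sub_right hZ' rfl)
  have hrH : Commute (hermitianRe Z) H := (Commute.add_left hZH hZsH).smul_left _
  have hiH : Commute (hermitianIm Z) H := (Commute.sub_left hZH hZsH).smul_left _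
  obtain ⟨b, γ, hb⟩ := exists_orthonormalBasis_of_commute
    (T := ![hermitianRe Z, hermitianIm Z, H])
    (fun i => by fin_cases i <;> assumption)
    (fun i j => by
      fin_cases i <;> fin_cases j <;>
        first | exact Commute.refl _ | assumption | exact Commute.symm (by assumption))
  let U : Matrix ι ι ℂ := Matrix.of fun i j => b j i
  have hUU : Uᴴ * U = 1 := by
    ext i j
    have h1 := orthonormal_iff_ite.mp b.orthonormal i j
    rw [EuclideanSpace.inner_eq_star_dotProduct] at h1
    rw [Matrix.one_apply, ← h1, Matrix.mul_apply, dotProduct]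
    simp [U, mul_comm]
  have hcol : ∀ l, ![hermitianRe Z, hermitianIm Z, H] l * U =
      U * Matrix.diagonal fun j => γ j l := by
    intro l
    ext i j
    have h1 := congrArg (fun v : EuclideanSpace ℂ ι => v i) (hb l j)
    rw [Matrix.mul_diagonal, Matrix.mul_apply]
    simpa [Matrix.toLpLin_apply, Matrix.mulVec, dotProduct, U, mul_comm] using h1
  have hdiag : ∀ l, Uᴴ * ![hermitianRe Z, hermitianIm Z, H] l * U =
      Matrix.diagonal fun j => γ j l := fun l => by
    rw [Matrix.mul_assoc, hcol, ← Matrix.mul_assoc, hUU, Matrix.one_mul]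
  have h0 : Uᴴ * hermitianRe Z * U = Matrix.diagonal fun j => γ j 0 := hdiag 0
  have h1 : Uᴴ * hermitianIm Z * U = Matrix.diagonal fun j => γ j 1 := hdiag 1
  have h2 : Uᴴ * H * U = Matrix.diagonal fun j => γ j 2 := hdiag 2
  have hsum : Z = hermitianRe Z + Complex.I • hermitianIm Z := by
    rw [hermitianRe, hermitianIm, smul_smul, mul_one_div, div_mul_cancel_right₀ Complex.I_ne_zero]
    module
  refine ⟨fun j => γ j 0 + Complex.I * γ j 1, fun j => (γ j 2).re, U,
    Matrix.mem_unitaryGroup_iff'.mpr hUU, ?_, ?_⟩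
  · nth_rewrite 1 [hsum]
    rw [Matrix.mul_add, Matrix.add_mul, Matrix.mul_smul, Matrix.smul_mul, h0, h1,
      ← Matrix.diagonal_smul, Matrix.diagonal_add]
    rfl
  · have hreal : ∀ j, ((γ j 2).re : ℂ) = γ j 2 := fun j => by
      have h3 : (Uᴴ * H * U).IsHermitian := Matrix.isHermitian_conjTranspose_mul_mul U hH
      rw [h2] at h3
      have h4 := h3.apply j j
      rw [Matrix.diagonal_apply_eq] at h4
      exact Complex.conj_eq_iff_re.mp h4
    simp only [hreal, h2]

end JointEigenvalues

end HigherRank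

theorem theorem2p3 (n r : ℕ) (hr : 0 < r) (hrn : r < n) (hn : n ≤ 2 * r) (α β : ℂ)
    (C : Matrix (Fin r) (Fin (n - r)) ℂ) (D : Matrix (Fin (n - r)) (Fin r) ℂ)
    (A : Matrix (Fin r ⊕ Fin (n - r)) (Fin r ⊕ Fin (n - r)) ℂ)
    (hA : A = Matrix.fromBlocks (α • 1) C D (β • 1))
    (hZ : IsStarNormal (D * C)) (hZH : Commute (D * C) (Cᴴ * C + D * Dᴴ)) :
    (∃ (z : Fin (n - r) → ℂ) (h : Fin (n - r) → ℝ),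
      HigherRank.IsJointEigenvalues (D * C) (Cᴴ * C + D * Dᴴ) z h) ∧
    ∀ (z : Fin (n - r) → ℂ) (h : Fin (n - r) → ℝ),
      HigherRank.IsJointEigenvalues (D * C) (Cᴴ * C + D * Dᴴ) z h →
      (∀ j, 0 ≤ HigherRank.majorSq α β (z j) (h j) ∧ 0 ≤ HigherRank.minorSq α β (z j) (h j)) ∧
      ∃ E : Fin (n - r) → Set ℂ,
        (∀ j, HigherRank.IsEllipse (E j)
          (HigherRank.focusPlus α β (z j)) (HigherRank.focusMinus α β (z j))
          (√(HigherRank.majorSq α β (z j) (h j))) (√(HigherRank.minorSq α β (z j) (h j)))) ∧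
        -- the Kippenhahn curve and the numerical range
        (n < 2 * r → HigherRank.kippenhahnCurve A = (⋃ j, E j) ∪ {α}) ∧
        (n = 2 * r → HigherRank.kippenhahnCurve A = ⋃ j, E j) ∧
        HigherRank.numericalRange A = convexHull ℝ (⋃ j, E j) ∧
        -- the higher rank numerical ranges
        (∀ k, 1 ≤ k → k ≤ n - r →
          HigherRank.higherRankNumericalRange k A =
            ⋂ (J : Finset (Fin (n - r))) (_ : J.card = n - r - k + 1),
              convexHull ℝ (⋃ j ∈ J, E j)) ∧
        (∀ k, n - r < k →
          k ≤ r + {j | HigherRank.majorSq α β (z j) (h j) = 0}.ncard →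
          HigherRank.higherRankNumericalRange k A = {α}) ∧
        (∀ k, r + {j | HigherRank.majorSq α β (z j) (h j) = 0}.ncard < k → k ≤ n →
          HigherRank.higherRankNumericalRange k A = ∅) := by
  open HigherRank in
  have hherm : (Cᴴ * C + D * Dᴴ).IsHermitian :=
    (Matrix.isHermitian_conjTranspose_mul_self C).add (Matrix.isHermitian_mul_conjTranspose_self D)
  refine ⟨exists_isJointEigenvalues hZ hherm hZH, ?_⟩
  rintro z h ⟨U, hU, hUZ, hUH⟩
  have hU1 : Uᴴ * U = 1 := Matrix.mem_unitaryGroup_iff'.mp hU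
  have hz : (Uᴴ * D) * (C * U) = Matrix.diagonal z := by
    rw [← hUZ]
    simp only [Matrix.mul_assoc]
  have hh : (C * U)ᴴ * (C * U) + (Uᴴ * D) * (Uᴴ * D)ᴴ =
      Matrix.diagonal fun j => (h j : ℂ) := by
    rw [← hUH]
    simp only [Matrix.conjTranspose_mul, Matrix.conjTranspose_conjTranspose, Matrix.mul_assoc,
      Matrix.mul_add, Matrix.add_mul]
  have hcard : Fintype.card (Fin (n - r)) ≤ Fintype.card (Fin r) := by
    rw [Fintype.card_fin, Fintype.card_fin]
    omega
  -- `A` may be replaced by its conjugate by `1 ⊕ U`, for which `D C` and `H` are diagonal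
  let X : Matrix (Fin r ⊕ Fin (n - r)) (Fin r ⊕ Fin (n - r)) ℂ := Matrix.fromBlocks 1 0 0 U
  have hX : X ∈ Matrix.unitaryGroup (Fin r ⊕ Fin (n - r)) ℂ := by
    rw [Matrix.mem_unitaryGroup_iff', Matrix.star_eq_conjTranspose, Matrix.fromBlocks_conjTranspose,
      Matrix.fromBlocks_multiply]
    simp [hU1]
  have hXA : Xᴴ * A * X = Matrix.fromBlocks (α • 1) (C * U) (Uᴴ * D) (β • 1) := by
    rw [hA, Matrix.fromBlocks_conjTranspose, Matrix.fromBlocks_multiply, Matrix.fromBlocks_multiply]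
    simp [hU1]
  have hΛ : ∀ k, higherRankNumericalRange k A = higherRankNumericalRange k
      (Matrix.fromBlocks (α • 1) (C * U) (Uᴴ * D) (β • 1)) := fun k => by
    rw [← hXA, higherRankNumericalRange_conj hX]
  have hcurve : kippenhahnCurve A = componentDuals (pointForm α ^ (r - (n - r))) ∪
      ⋃ j, ellipseOf α β (z j) (h j) := by
    have h1 := kippenhahnCurve_fromBlocks hz hh hcard α β
    rw [kippenhahnCurve, ← hXA, kippenhahnPolynomial_conj hX, Fintype.card_fin,
      Fintype.card_fin] at h1
    exact h1
  have hinter : ∀ k, k ≤ n - r → higherRankNumericalRange k A =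
      ⋂ (J : Finset (Fin (n - r))) (_ : J.card = n - r - k + 1),
        convexHull ℝ (⋃ j ∈ J, ellipseOf α β (z j) (h j)) := fun k hk => by
    have h1 := higherRankNumericalRange_fromBlocks_eq_iInter hz hh hcard α β (k := k)
      (by rwa [Fintype.card_fin])
    rw [hΛ, h1, Fintype.card_fin]
  have hpoint := fun k => alpha_mem_higherRankNumericalRange_fromBlocks_iff hz hh α β (k := k)
  have hsub := fun k => higherRankNumericalRange_fromBlocks_subset hz hh α β (k := k)
  simp only [Fintype.card_fin, ← hΛ] at hpoint hsub
  refine ⟨fun j => ⟨majorSq_nonneg (two_mul_norm_le hz hh j),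
    minorSq_nonneg (two_mul_norm_le hz hh j)⟩, fun j => ellipseOf α β (z j) (h j),
    fun j => isEllipse_ellipseOf (two_mul_norm_le hz hh j), ?_, ?_, ?_, fun k _ hk => hinter k hk,
    ?_, ?_⟩
  · intro hlt
    have hne : r - (n - r) ≠ 0 := by omega
    rw [hcurve, componentDuals_pow _ hne, componentDuals_pointForm, Set.union_comm]
  · intro heq
    rw [hcurve, show r - (n - r) = 0 by omega, pow_zero, componentDuals_one, Set.empty_union]
  · have huniv : ∀ J : Finset (Fin (n - r)), J.card = n - r - 1 + 1 ↔ J = Finset.univ := by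
      intro J
      rw [Nat.sub_add_cancel (by omega), ← Finset.card_eq_iff_eq_univ, Fintype.card_fin]
    rw [numericalRange_eq_higherRankNumericalRange_one, hinter 1 (by omega)]
    simp [huniv]
  · intro k hk hkm
    exact (hsub k hk).antisymm (Set.singleton_subset_iff.mpr ((hpoint k).mpr hkm))
  · intro k hk _
    refine Set.eq_empty_of_forall_notMem fun w hw => ?_
    have hw' : w = α := hsub k (by omega) hw
    exact absurd ((hpoint k).mp (hw' ▸ hw)) (by omega)
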